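/- **Conventions.** An integral quadratic form $\mathbf q$ in $m$ variables is a quadratic form on $\mathbb Z^m$ with integer coefficients; its matrix is the even matrix $Q$ with $2\mathbf q(X)={}^tXQX$, and $\det\mathbf q=\det Q$; it is nonsingular if $\det\mathbf q\neq 0$. For integral forms, $R(\mathbf q,\mathbf q')$ is the set of integral matrices $A$ with $\mathbf q(AX)=\mathbf q'(X)$, $R^*(\mathbf q,\mathbf q')$ is the subset of those $A$ whose entries are coprime, and $E(\mathbf q)=R(\mathbf q,\mathbf q)\cap GL_m(\mathbb Z)$. A form $\mathbf q'$ in the same number of variables is similar to $\mathbf q$ if $\det\mathbf q'=\det\mathbf q$ and $R(\mathbf q,a\mathbf q')\ne\emptyset$ for some nonzero integer $a$ prime to $\det\mathbf q$. For a ternary $\mathbf q$, let $C_0(\mathbf q)$ be the even subalgebra of the Clifford algebra of $(\mathbb Z^3,\mathbf q)$ over $\mathbb Z$, with natural basis $1,\ e_2e_3,\ -e_1e_3,\ e_1e_2$ and norm $x\mapsto x\bar x\in\mathbb Z$, where $x\mapsto\bar x$ is the antiautomorphism with $\bar e_j=-e_j$. **The lift.** Let $p$ be a prime not dividing $\det\mathbf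 q$ and let $A\in R(\mathbf q',p^2\mathbf q'')$ with $\mathbf q',\mathbf q''$ ternary and similar to $\mathbf q$. By the universal property $A$ induces a ring homomorphism $\varphi_A:C_0(p^2\mathbf q'')\to C_0(\mathbf q')$; let $\Phi_A$ be its matrix in the natural bases and put $$\Psi_A=\Phi_A\cdot\mathrm{diag}(p,p^{-1},p^{-1},p^{-1}).$$ The columns of $\Psi_A$ are coordinate columns of elements of $C_0(\mathbf q')$ which span the image $\varphi_A(p\,C_0(\mathbf q''))$ under the extension of $\varphi_A$ to $C_0(\mathbf q'')\otimes\mathbb Q\to C_0(\mathbf q')\otimes\mathbb Q$, where $C_0(p^2\mathbf q'')$ is identified with the subring of $C_0(\mathbf q'')$ spanned by $1,\ p^2e_2e_3,\ -p^2e_1e_3,\ p^2e_1e_2$. Let $$\mathfrak I_A=C_0(\mathbf q')\cdot\varphi_A\bigl(p\,C_0(\mathbf q'')\bigr)$$ be the left ideal of $C_0(\mathbf q')$ it generates, and let $\mathcal I_A$ denote any generating matrix of $\mathfrak I_A$, i.e. an integral $4\times4$ matrix for which $\mathcal I_A\mathbb Z^4$ is the lattice of coordinate columns of $\mathfrak I_A$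 in a fixed basis of $C_0(\mathbf q')$. **Theorem 6.7.** Let $\mathbf q$ be an integral nonsingular ternary quadratic form and let $\mathbf n$ be the integral quaternary quadratic form given by the norm on $C_0(\mathbf q)$ in some $\mathbb Z$-basis of $C_0(\mathbf q)$ (so $\mathbf n$ is defined up to integral equivalence). Let $\{\mathbf q_1,\dots,\mathbf q_h\}$ and $\{\mathbf n_1,\dots,\mathbf n_H\}$ be complete systems of representatives of the different integral equivalence classes in the similarity classes of $\mathbf q$ and of $\mathbf n$ respectively. Let $p$ be a prime not dividing $\det\mathbf q$. Then the chain $$A\ \mapsto\ \Psi_A\ \mapsto\ p^2\Psi_A^{-1}=\Psi_{p^2A^{-1}}\ \mapsto\ \mathcal I_{p^2A^{-1}}\ \mapsto\ p\,(\mathcal I_{p^2A^{-1}})^{-1}=\Upsilon_A,$$ in which the generating matrix $\mathcal I_{p^2A^{-1}}$ of the left ideal $\mathfrak I_{p^2A^{-1}}$ of $C_0(\mathbf q)$ is taken in the chosen basis and so that $\Upsilon_A\in R(\mathbf n_j,p\,\mathbf n)$ for some $j$, yields a well-defined map of classes $$\Upsilon:\ \bigcup_{i=1}^h E(\mathbf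 q_i)\backslash R^*(\mathbf q_i,p^2\mathbf q)\ \longrightarrow\ \bigcup_{j=1}^H E(\mathbf n_j)\backslash R(\mathbf n_j,p\,\mathbf n),$$ and the class $\Upsilon(E(\mathbf q_i)A)$ consists of all matrices in $\bigcup_j R(\mathbf n_j,p\,\mathbf n)$ that arise from $A$ in this way. The map $\Upsilon$ is injective, and for every $A$ the automorph $\Upsilon_A$ divides $\Psi_A$ from the right: $\Psi_A=X\,\Upsilon_A$ with an integral $4\times4$ matrix $X$ (the columns of $\Psi_A$ being referred to the chosen basis of $C_0(\mathbf q)$). -/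

import Mathlib

/-!
Integral quadratic forms in `m` variables are quadratic forms on `Fin m → ℤ`.
Representations and automorphs are integral matrices acting on column vectors.
-/

namespace AutomorphLift

open Matrix

/-- The determinant of an integral quadratic form: the determinant of the even matrix
`(q(eᵢ + eⱼ) - q(eᵢ) - q(eⱼ))ᵢⱼ`. -/
def formDet {m : ℕ} (q : QuadraticForm ℤ (Fin m → ℤ)) : ℤ :=
  (Matrix.of fun i j : Fin m =>
    QuadraticMap.polar q (Pi.single i 1) (Pi.single j 1)).det

/-- `R(q, q')`: integral representations of `q'` by `q`, i.e. integral `A` with `q(A X) = q'(X)`. -/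
def reps {m n : ℕ} (q : QuadraticForm ℤ (Fin m → ℤ)) (q' : QuadraticForm ℤ (Fin n → ℤ)) :
    Set (Matrix (Fin m) (Fin n) ℤ) :=
  {A | ∀ X : Fin n → ℤ, q (A *ᵥ X) = q' X}

/-- `R*(q, q')`: the primitive representations, those whose entries are coprime. -/
def primReps {m n : ℕ} (q : QuadraticForm ℤ (Fin m → ℤ)) (q' : QuadraticForm ℤ (Fin n → ℤ)) :
    Set (Matrix (Fin m) (Fin n) ℤ) :=
  {A | A ∈ reps q q' ∧ ∀ d : ℤ, (∀ i j, d ∣ A i j) → IsUnit d}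

/-- `E(q)`: the group of units of `q`. -/
def formUnits {m : ℕ} (q : QuadraticForm ℤ (Fin m → ℤ)) : Subgroup (GL (Fin m) ℤ) where
  carrier := {U | (U : Matrix (Fin m) (Fin m) ℤ) ∈ reps q q}
  one_mem' := by intro X; simp
  mul_mem' := by
    intro U V hU hV X
    rw [Units.val_mul, ← Matrix.mulVec_mulVec, hU, hV]
  inv_mem' := by
    intro U hU X
    have h := hU ((U⁻¹ : GL (Fin m) ℤ).val *ᵥ X)
    rw [Matrix.mulVec_mulVec, ← Units.val_mul, mul_inv_cancel, Units.val_one,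
      Matrix.one_mulVec] at h
    exact h.symm

/-- Two elements of a set `S` of matrices are in the same left class modulo `E(q)` if they differ
by left multiplication by a unit of `q`. -/
def leftClassSetoid {m n : ℕ} (q : QuadraticForm ℤ (Fin m → ℤ))
    (S : Set (Matrix (Fin m) (Fin n) ℤ)) : Setoid S where
  r A D := ∃ U ∈ formUnits q, A.1 = (U : Matrix (Fin m) (Fin m) ℤ) * D.1
  iseqv :=
    { refl := fun A => ⟨1, one_mem _, by simp⟩
      symm := by
        rintro A D ⟨U, hU, h⟩
        refine ⟨U⁻¹, inv_mem hU, ?_⟩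
        rw [h, ← Matrix.mul_assoc, ← Units.val_mul, inv_mul_cancel, Units.val_one,
          Matrix.one_mul]
      trans := by
        rintro A D F ⟨U, hU, h⟩ ⟨V, hV, h'⟩
        exact ⟨U * V, mul_mem hU hV, by rw [h, h', Units.val_mul, Matrix.mul_assoc]⟩ }

/-- `E(q) \ S`. -/
def LeftClasses {m n : ℕ} (q : QuadraticForm ℤ (Fin m → ℤ))
    (S : Set (Matrix (Fin m) (Fin n) ℤ)) : Type :=
  Quotient (leftClassSetoid q S)

/-- The left class `E(q) A` of an element `A` of `S`. -/
def leftClass {m n : ℕ} (q : QuadraticForm ℤ (Fin m → ℤ))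
    {S : Set (Matrix (Fin m) (Fin n) ℤ)} (A : S) : LeftClasses q S :=
  Quotient.mk (leftClassSetoid q S) A

/-- `q'` is similar to `q`: the determinants agree and `R(q, a q')` is non-empty for some nonzero
multiplier `a` prime to `det q`. -/
def IsSimilar {m : ℕ} (q q' : QuadraticForm ℤ (Fin m → ℤ)) : Prop :=
  formDet q' = formDet q ∧
    ∃ a : ℤ, a ≠ 0 ∧ IsCoprime a (formDet q) ∧ (reps q (a • q')).Nonempty

/-- `qs` is a complete system of representatives of the different integral equivalence classes
contained in the similarity class of `q`. -/
def IsCompleteSystem {m h : ℕ} (q : QuadraticForm ℤ (Fin m → ℤ))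
    (qs : Fin h → QuadraticForm ℤ (Fin m → ℤ)) : Prop :=
  (∀ i, IsSimilar q (qs i)) ∧
    ∀ q' : QuadraticForm ℤ (Fin m → ℤ), IsSimilar q q' →
      ∃! i, QuadraticMap.Equivalent (qs i) q'

/-! ### The even Clifford algebra of a ternary form and its natural basis -/

section Ternary

variable (q : QuadraticForm ℤ (Fin 3 → ℤ))

/-- The image in `C(E, q)` of the `i`-th standard basis vector of `E = ℤ³`. -/
noncomputable def basisVec (i : Fin 3) : CliffordAlgebra q :=
  CliffordAlgebra.ι q (Pi.single i 1)

/-- The product `eᵢ eⱼ` as an element of the even subalgebra `C₀(E, q)`. -/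
noncomputable def evenProd (i j : Fin 3) : CliffordAlgebra.even q :=
  ⟨basisVec q i * basisVec q j, CliffordAlgebra.ι_mul_ι_mem_evenOdd_zero q _ _⟩

/-- The natural family `e₀ = 1, e₂₃, -e₁₃, e₁₂` (indices of the vectors shifted to `0, 1, 2`). -/
noncomputable def natFamily : Fin 4 → CliffordAlgebra.even q :=
  ![1, evenProd q 1 2, -evenProd q 0 2, evenProd q 0 1]

theorem vec_sq (i : Fin 3) :
    basisVec q i * basisVec q i = q (Pi.single i 1) • (1 : CliffordAlgebra q) := by
  rw [basisVec, CliffordAlgebra.ι_sq_scalar, Algebra.algebraMap_eq_smul_one]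

theorem vec_comm (i j : Fin 3) :
    basisVec q j * basisVec q i =
      QuadraticMap.polar q (Pi.single i 1) (Pi.single j 1) • (1 : CliffordAlgebra q)
        - basisVec q i * basisVec q j := by
  rw [← Algebra.algebraMap_eq_smul_one, basisVec, basisVec, CliffordAlgebra.ι_mul_ι_comm,
    QuadraticMap.polar_comm]

theorem vec_sq_mul (i : Fin 3) (x : CliffordAlgebra q) :
    basisVec q i * (basisVec q i * x) = q (Pi.single i 1) • x := by
  rw [← mul_assoc, vec_sq, smul_mul_assoc, one_mul]

theorem vec_comm_mul (i j : Fin 3) (x : CliffordAlgebra q) :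
    basisVec q j * (basisVec q i * x) =
      QuadraticMap.polar q (Pi.single i 1) (Pi.single j 1) • x
        - basisVec q i * (basisVec q j * x) := by
  rw [← mul_assoc, vec_comm, sub_mul, smul_mul_assoc, one_mul, mul_assoc]

theorem scalar_injective :
    Function.Injective (algebraMap ℤ (CliffordAlgebra q)) := by
  obtain ⟨B, hB⟩ := LinearMap.BilinMap.toQuadraticMap_surjective (R := ℤ) (M := Fin 3 → ℤ) (-q)
  have h : B.toQuadraticMap = 0 - q := by rw [hB, zero_sub]
  intro a c hac
  have := congrArg (CliffordAlgebra.changeForm h) hac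
  rw [CliffordAlgebra.changeForm_algebraMap, CliffordAlgebra.changeForm_algebraMap] at this
  exact (ExteriorAlgebra.algebraMap_leftInverse (R := ℤ) (Fin 3 → ℤ)).injective this


/-- The span of `1, e₂e₃, e₁e₃, e₁e₂`. -/
def evenSpan : Submodule ℤ (CliffordAlgebra q) :=
  Submodule.span ℤ {1, basisVec q 1 * basisVec q 2, basisVec q 0 * basisVec q 2, basisVec q 0 * basisVec q 1}

/-- The span of `e₁, e₂, e₃, e₁e₂e₃`. -/
def oddSpan : Submodule ℤ (CliffordAlgebra q) :=
  Submodule.span ℤ {basisVec q 0, basisVec q 1, basisVec q 2, basisVec q 0 * (basisVec q 1 * basisVec q 2)}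

theorem ι_eq (m : Fin 3 → ℤ) :
    CliffordAlgebra.ι q m = m 0 • basisVec q 0 + m 1 • basisVec q 1 + m 2 • basisVec q 2 := by
  have hm : m = m 0 • Pi.single (0 : Fin 3) (1 : ℤ) + m 1 • Pi.single (1 : Fin 3) (1 : ℤ)
      + m 2 • Pi.single (2 : Fin 3) (1 : ℤ) := by
    ext i; fin_cases i <;> simp
  conv_lhs => rw [hm]
  simp only [map_add, map_smul, basisVec]

theorem ι_mul_evenSpan (m : Fin 3 → ℤ) {x : CliffordAlgebra q} (hx : x ∈ evenSpan q) :
    CliffordAlgebra.ι q m * x ∈ oddSpan q := by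
  have h0 : basisVec q 0 ∈ oddSpan q := Submodule.subset_span (by simp)
  have h1 : basisVec q 1 ∈ oddSpan q := Submodule.subset_span (by simp)
  have h2 : basisVec q 2 ∈ oddSpan q := Submodule.subset_span (by simp)
  have h3 : basisVec q 0 * (basisVec q 1 * basisVec q 2) ∈ oddSpan q := Submodule.subset_span (by simp)
  induction hx using Submodule.span_induction with
  | zero => simp
  | add x y _ _ hx hy => rw [mul_add]; exact add_mem hx hy
  | smul a x _ hx => rw [mul_smul_comm]; exact Submodule.smul_mem _ _ hx
  | mem x hx =>
    rcases hx with rfl | rfl | rfl | rfl <;>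
    · simp only [ι_eq, add_mul, smul_mul_assoc, mul_one, vec_sq, vec_sq_mul,
        vec_comm q 1 2, vec_comm_mul q 0 1, vec_comm_mul q 0 2, vec_comm_mul q 1 2, mul_sub, mul_smul_comm, smul_sub, smul_smul]
      repeat' first
        | assumption
        | apply add_mem
        | apply sub_mem
        | apply Submodule.smul_mem

theorem ι_mul_oddSpan (m : Fin 3 → ℤ) {x : CliffordAlgebra q} (hx : x ∈ oddSpan q) :
    CliffordAlgebra.ι q m * x ∈ evenSpan q := by
  have h0 : (1 : CliffordAlgebra q) ∈ evenSpan q := Submodule.subset_span (by simp)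
  have h1 : basisVec q 1 * basisVec q 2 ∈ evenSpan q := Submodule.subset_span (by simp)
  have h2 : basisVec q 0 * basisVec q 2 ∈ evenSpan q := Submodule.subset_span (by simp)
  have h3 : basisVec q 0 * basisVec q 1 ∈ evenSpan q := Submodule.subset_span (by simp)
  induction hx using Submodule.span_induction with
  | zero => simp
  | add x y _ _ hx hy => rw [mul_add]; exact add_mem hx hy
  | smul a x _ hx => rw [mul_smul_comm]; exact Submodule.smul_mem _ _ hx
  | mem x hx =>
    rcases hx with rfl | rfl | rfl | rfl <;>
    · simp only [ι_eq, add_mul, smul_mul_assoc, mul_one, vec_sq, vec_sq_mul,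
        vec_comm q 0 1, vec_comm q 0 2, vec_comm q 1 2, vec_comm_mul q 0 1,
        vec_comm_mul q 0 2, vec_comm_mul q 1 2, mul_sub, mul_smul_comm, smul_sub, smul_smul]
      repeat' first
        | assumption
        | apply add_mem
        | apply sub_mem
        | apply Submodule.smul_mem

theorem mem_evenSpan {x : CliffordAlgebra q} (hx : x ∈ CliffordAlgebra.evenOdd q 0) :
    x ∈ evenSpan q := by
  induction x, hx using CliffordAlgebra.even_induction with
  | algebraMap r =>
    rw [Algebra.algebraMap_eq_smul_one]
    exact Submodule.smul_mem _ _ (Submodule.subset_span (by simp))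
  | add x y _ _ hx hy => exact add_mem hx hy
  | ι_mul_ι_mul m₁ m₂ x _ hx =>
    rw [mul_assoc]
    exact ι_mul_oddSpan q _ (ι_mul_evenSpan q _ hx)

theorem natFamily_span : ⊤ ≤ Submodule.span ℤ (Set.range (natFamily q)) := by
  rintro ⟨x, hx⟩ -
  have hx' : x ∈ evenSpan q := mem_evenSpan q hx
  have key : evenSpan q ≤
      (Submodule.span ℤ (Set.range (natFamily q))).map
        (CliffordAlgebra.even q).val.toLinearMap := by
    refine Submodule.span_le.2 ?_
    rintro y (rfl | rfl | rfl | rfl)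
    · exact ⟨_, Submodule.subset_span ⟨0, rfl⟩, rfl⟩
    · exact ⟨_, Submodule.subset_span ⟨1, rfl⟩, rfl⟩
    · exact ⟨_, neg_mem (Submodule.subset_span ⟨2, rfl⟩), by simp [natFamily, evenProd]⟩
    · exact ⟨_, Submodule.subset_span ⟨3, rfl⟩, rfl⟩
  obtain ⟨y, hy, hyx⟩ := key hx'
  have : y = ⟨x, hx⟩ := Subtype.ext hyx
  exact this ▸ hy

theorem natFamily_linearIndependent : LinearIndependent ℤ (natFamily q) := by
  rw [Fintype.linearIndependent_iff]
  intro g hg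
  have h : g 0 • (1 : CliffordAlgebra q) + g 1 • (basisVec q 1 * basisVec q 2)
      - g 2 • (basisVec q 0 * basisVec q 2) + g 3 • (basisVec q 0 * basisVec q 1) = 0 := by
    have := congrArg (CliffordAlgebra.even q).val hg
    simpa [Fin.sum_univ_four, natFamily, evenProd, sub_eq_add_neg] using this
  let d (k : Fin 3) : Module.Dual ℤ (Fin 3 → ℤ) := LinearMap.proj k
  have hc (f : Module.Dual ℤ (Fin 3 → ℤ)) (c : ℤ) :
      CliffordAlgebra.contractLeft f (c : CliffordAlgebra q) = 0 := by
    simpa using CliffordAlgebra.contractLeft_algebraMap q f c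
  have hd (k l : Fin 3) := congrArg
    (fun x => CliffordAlgebra.contractLeft (d k) (CliffordAlgebra.contractLeft (d l) x)) h
  have h1 : g 1 = 0 := scalar_injective q (by
    simpa [-zsmul_eq_mul, hc, basisVec, d, CliffordAlgebra.contractLeft_ι_mul, CliffordAlgebra.contractLeft_ι,
      Algebra.algebraMap_eq_smul_one] using hd 2 1)
  have h2 : g 2 = 0 := scalar_injective q (by
    simpa [-zsmul_eq_mul, hc, basisVec, d, CliffordAlgebra.contractLeft_ι_mul, CliffordAlgebra.contractLeft_ι,
      Algebra.algebraMap_eq_smul_one] using hd 2 0)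
  have h3 : g 3 = 0 := scalar_injective q (by
    simpa [-zsmul_eq_mul, hc, basisVec, d, CliffordAlgebra.contractLeft_ι_mul, CliffordAlgebra.contractLeft_ι,
      Algebra.algebraMap_eq_smul_one] using hd 1 0)
  have h0 : g 0 = 0 := scalar_injective q (by
    simpa [h1, h2, h3, Algebra.algebraMap_eq_smul_one] using h)
  intro i
  fin_cases i <;> assumption

/-- The natural basis `e₀, e₂₃, -e₁₃, e₁₂` of the even subalgebra `C₀(E, q)`. -/
noncomputable def natBasis : Module.Basis (Fin 4) ℤ (CliffordAlgebra.even q) :=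
  Module.Basis.mk (natFamily_linearIndependent q) (natFamily_span q)

/-- The standard involution `x ↦ x̄` of `C₀(E, q)`, the restriction of the antiautomorphism of
`C(E, q)` with `ēⱼ = -eⱼ`. -/
noncomputable def evenConj (x : CliffordAlgebra.even q) : CliffordAlgebra.even q :=
  ⟨star (x : CliffordAlgebra q), by
    have hx : (x : CliffordAlgebra q) ∈ CliffordAlgebra.evenOdd q 0 := x.2
    change star (x : CliffordAlgebra q) ∈ CliffordAlgebra.evenOdd q 0
    rw [CliffordAlgebra.star_def, CliffordAlgebra.reverse_mem_evenOdd_iff,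
      CliffordAlgebra.involute_mem_evenOdd_iff]
    exact hx⟩

/-- The bilinear map sending `(x, y)` to the `e₀`-coordinate of `x ȳ`. -/
noncomputable def normBilin : LinearMap.BilinForm ℤ (CliffordAlgebra.even q) :=
  LinearMap.mk₂ ℤ (fun x y => (natBasis q).repr (x * evenConj q y) 0)
    (by intro x y z; simp [add_mul])
    (by intro c x y; rw [smul_mul_assoc, map_smul]; rfl)
    (by
      intro x y z
      have : evenConj q (y + z) = evenConj q y + evenConj q z := Subtype.ext (by simp [evenConj])
      simp [this, mul_add])
    (by
      intro c x y
      have : evenConj q (c • y) = c • evenConj q y := Subtype.ext (CliffordAlgebra.star_smul c _)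
      rw [this, mul_smul_comm, map_smul]; rfl)

/-- The norm `x ↦ x x̄` on `C₀(E, q)`, as an integral quadratic form on the free module
`C₀(E, q)`; the product `x x̄` is the integer `evenNorm q x`, see `evenNorm_spec`. -/
noncomputable def evenNorm : QuadraticForm ℤ (CliffordAlgebra.even q) :=
  (normBilin q).toQuadraticMap

theorem conj_natFamily (g : Fin 4 → ℤ) :
    (evenConj q (∑ i, g i • natFamily q i) : CliffordAlgebra q) =
      g 0 • (1 : CliffordAlgebra q) + g 1 • (basisVec q 2 * basisVec q 1)
        - g 2 • (basisVec q 2 * basisVec q 0) + g 3 • (basisVec q 1 * basisVec q 0) := by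
  simp [-zsmul_eq_mul, evenConj, natFamily, evenProd, Fin.sum_univ_four, basisVec, sub_eq_add_neg]

/-- The value of `x x̄` in coordinates with respect to the natural basis. -/
def normValue (g : Fin 4 → ℤ) : ℤ :=
  let q1 := q (Pi.single 0 1)
  let q2 := q (Pi.single 1 1)
  let q3 := q (Pi.single 2 1)
  let b12 := QuadraticMap.polar q (Pi.single 0 1) (Pi.single 1 1)
  let b13 := QuadraticMap.polar q (Pi.single 0 1) (Pi.single 2 1)
  let b23 := QuadraticMap.polar q (Pi.single 1 1) (Pi.single 2 1)
  g 0 ^ 2 + g 0 * (g 1 * b23 - g 2 * b13 + g 3 * b12)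
    + g 1 ^ 2 * (q2 * q3) + g 2 ^ 2 * (q1 * q3) + g 3 ^ 2 * (q1 * q2)
    - g 1 * g 2 * (q3 * b12) + g 1 * g 3 * (b12 * b23 - q2 * b13) - g 2 * g 3 * (q1 * b23)

theorem mul_conj_natFamily (g : Fin 4 → ℤ) :
    (∑ i, g i • natFamily q i) * evenConj q (∑ i, g i • natFamily q i) =
      algebraMap ℤ _ (normValue q g) := by
  refine Subtype.ext ?_
  have hx : ((∑ i, g i • natFamily q i : CliffordAlgebra.even q) : CliffordAlgebra q) =
      g 0 • (1 : CliffordAlgebra q) + g 1 • (basisVec q 1 * basisVec q 2)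
        - g 2 • (basisVec q 0 * basisVec q 2) + g 3 • (basisVec q 0 * basisVec q 1) := by
    simp [-zsmul_eq_mul, natFamily, evenProd, Fin.sum_univ_four, sub_eq_add_neg]
  have hr : ((algebraMap ℤ (CliffordAlgebra.even q) (normValue q g) : CliffordAlgebra.even q) :
      CliffordAlgebra q) = normValue q g • (1 : CliffordAlgebra q) := by
    rw [Algebra.algebraMap_eq_smul_one]; rfl
  rw [MulMemClass.coe_mul, conj_natFamily, hx, hr, normValue]
  simp only [mul_add, add_mul, sub_mul, mul_sub, smul_mul_assoc, mul_smul_comm, mul_assoc,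
    mul_one, one_mul, vec_sq, vec_sq_mul, vec_comm q 0 1, vec_comm q 0 2, vec_comm q 1 2,
    vec_comm_mul q 0 1, vec_comm_mul q 0 2, vec_comm_mul q 1 2]
  module

theorem evenNorm_spec (x : CliffordAlgebra.even q) :
    x * evenConj q x = algebraMap ℤ _ (evenNorm q x) := by
  have hx := (natBasis q).sum_repr x
  have key : ∃ c : ℤ, x * evenConj q x = algebraMap ℤ _ c := by
    generalize (natBasis q).repr x = g at hx
    have hx' : ∑ i, g i • natFamily q i = x := by
      rw [← hx]; simp [natBasis]
    exact ⟨normValue q g, hx' ▸ mul_conj_natFamily q g⟩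
  obtain ⟨c, hc⟩ := key
  have h1 : (1 : CliffordAlgebra.even q) = natBasis q 0 := by simp [natBasis, natFamily]
  have : evenNorm q x = c := by
    change (natBasis q).repr (x * evenConj q x) 0 = c
    rw [hc, Algebra.algebraMap_eq_smul_one, h1, map_smul, Module.Basis.repr_self]
    simp
  rw [this, hc]

/-- The integral quaternary quadratic form given by the norm on `C₀(E, q)` in a `ℤ`-basis `b`. -/
noncomputable def normForm (b : Module.Basis (Fin 4) ℤ (CliffordAlgebra.even q)) :
    QuadraticForm ℤ (Fin 4 → ℤ) :=
  (evenNorm q).basisRepr b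

end Ternary

/-! ### The Clifford lift of automorphs -/

section Lift

variable {q q' : QuadraticForm ℤ (Fin 3 → ℤ)}

/-- The isometry `α_A` of quadratic modules from `(ℤ³, q')` to `(ℤ³, q)` given by `A ∈ R(q, q')`. -/
def toIsometry (A : reps q q') : q' →qᵢ q where
  toLinearMap := Matrix.mulVecLin A.1
  map_app' := A.2

/-- The restriction to the even subalgebras of the algebra homomorphism
`φ_A : C(E', q') → C(E, q)` induced by `α_A`. -/
noncomputable def evenMap (A : reps q q') :
    CliffordAlgebra.even q' →ₐ[ℤ] CliffordAlgebra.even q :=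
  ((CliffordAlgebra.map (toIsometry A)).comp (CliffordAlgebra.even q').val).codRestrict
    (CliffordAlgebra.even q) (by
      rintro ⟨x, hx⟩
      change CliffordAlgebra.map (toIsometry A) x ∈ CliffordAlgebra.evenOdd q 0
      induction x, hx using CliffordAlgebra.even_induction with
      | algebraMap r =>
        rw [AlgHom.commutes]
        exact SetLike.algebraMap_mem_graded _ _
      | add x y _ _ hx hy => rw [map_add]; exact add_mem hx hy
      | ι_mul_ι_mul m₁ m₂ x _ hx =>
        rw [map_mul, map_mul, CliffordAlgebra.map_apply_ι, CliffordAlgebra.map_apply_ι]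
        exact zero_add (0 : ZMod 2) ▸ SetLike.mul_mem_graded
          (CliffordAlgebra.ι_mul_ι_mem_evenOdd_zero q _ _) hx)

/-- `Φ_A`: the matrix of `φ_A : C₀(E', q') → C₀(E, q)` in the natural bases. -/
noncomputable def Phi (A : reps q q') : Matrix (Fin 4) (Fin 4) ℤ :=
  LinearMap.toMatrix (natBasis q') (natBasis q) (evenMap A).toLinearMap

/-- `Ψ_A = Φ_A · diag(p, p⁻¹, p⁻¹, p⁻¹)` for an automorph `A ∈ R(q, p² q')`, a priori a rational
matrix. As `C₀(E', p² q')` is the subring of `C₀(E', q')` with basis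
`e₀', p² e₂₃', -p² e₁₃', p² e₁₂'`, the homomorphism `φ_A` extends to an isomorphism from
`C₀(E', q') ⊗ ℚ` to `C₀(E, q) ⊗ ℚ`, whose matrix in the natural bases is `p⁻¹ Ψ_A`. -/
noncomputable def Psi (p : ℕ) (A : reps q ((p : ℤ) ^ 2 • q')) : Matrix (Fin 4) (Fin 4) ℚ :=
  (Phi A).map (Int.cast : ℤ → ℚ) *
    Matrix.diagonal ![(p : ℚ), (p : ℚ)⁻¹, (p : ℚ)⁻¹, (p : ℚ)⁻¹]

/-- `φ_A(p C₀(E', q'))`: the elements of `C₀(E, q)` whose coordinate column in the natural basis is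
an integral linear combination of the columns of `Ψ_A`. -/
def liftImage (p : ℕ) (A : reps q ((p : ℤ) ^ 2 • q')) : Set (CliffordAlgebra.even q) :=
  {x | ∃ z : Fin 4 → ℤ,
    (fun k => ((natBasis q).repr x k : ℚ)) = Psi p A *ᵥ (fun k => (z k : ℚ))}

/-- The extension `𝔍_A = C₀(E, q) · φ_A(p C₀(E', q'))`, a left ideal of `C₀(E, q)`. -/
def extIdeal (p : ℕ) (A : reps q ((p : ℤ) ^ 2 • q')) : Ideal (CliffordAlgebra.even q) :=
  Ideal.span (liftImage p A)

end Lift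

/-- `I` is a generating matrix of the left ideal `J` with respect to the basis `b`:
`J = (b₁, b₂, b₃, b₄) · I ℤ⁴`. -/
def IsGeneratingMatrix {q : QuadraticForm ℤ (Fin 3 → ℤ)}
    (b : Module.Basis (Fin 4) ℤ (CliffordAlgebra.even q))
    (J : Ideal (CliffordAlgebra.even q)) (I : Matrix (Fin 4) (Fin 4) ℤ) : Prop :=
  ∀ x : CliffordAlgebra.even q, x ∈ J ↔ ∃ z : Fin 4 → ℤ, b.equivFun x = I *ᵥ z

/-- `M` is a value `Υ_A` of the chain
`A ↦ Ψ_A ↦ p² Ψ_A⁻¹ = Ψ_B ↦ 𝓘_B ↦ p 𝓘_B⁻¹ = Υ_A`, where `B = p² A⁻¹ ∈ R(q, p² q')`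
and `𝓘_B` is a generating matrix (with respect to `b`) of the extension ideal `𝔍_B`.
The inverses are expressed by the equations `A B = p²`, `Ψ_A Ψ_B = p²` and `𝓘_B M = p`. -/
def IsUpsilon (p : ℕ) {q q' : QuadraticForm ℤ (Fin 3 → ℤ)}
    (b : Module.Basis (Fin 4) ℤ (CliffordAlgebra.even q))
    (A : reps q' ((p : ℤ) ^ 2 • q)) (M : Matrix (Fin 4) (Fin 4) ℤ) : Prop :=
  ∃ B : reps q ((p : ℤ) ^ 2 • q'),
    A.1 * B.1 = (p : ℤ) ^ 2 • (1 : Matrix (Fin 3) (Fin 3) ℤ) ∧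
    Psi p A * Psi p B = (p : ℚ) ^ 2 • (1 : Matrix (Fin 4) (Fin 4) ℚ) ∧
    ∃ I : Matrix (Fin 4) (Fin 4) ℤ, IsGeneratingMatrix b (extIdeal p B) I ∧
      I * M = (p : ℤ) • (1 : Matrix (Fin 4) (Fin 4) ℤ)

/-- `M` divides `Ψ_A` from the right: `Ψ_A = X M` with an integral matrix `X`. Here the columns of
`Ψ_A`, which are indexed by the natural basis of `C₀(E, q)`, are first rewritten in terms of the
basis `b` that `M` refers to; nothing changes if `b` is the natural basis. -/
def DividesPsi (p : ℕ) {q q' : QuadraticForm ℤ (Fin 3 → ℤ)}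
    (b : Module.Basis (Fin 4) ℤ (CliffordAlgebra.even q))
    (M : Matrix (Fin 4) (Fin 4) ℤ) (A : reps q' ((p : ℤ) ^ 2 • q)) : Prop :=
  ∃ X : Matrix (Fin 4) (Fin 4) ℤ,
    Psi p A * ((natBasis q).toMatrix b).map (Int.cast : ℤ → ℚ) =
      (X * M).map (Int.cast : ℤ → ℚ)

end AutomorphLift

open AutomorphLift

/-! Since `p` does not divide `det q`, the even Clifford algebra `C` of `q` is a 2×2 matrix algebra
modulo `p`. Only one consequence of this is used: the norm form stays nondegenerate modulo `p`
(`four_mul_formDet_natBasis`).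

The dual `B = p² A⁻¹` is again integral (`exists_dual`), and `p` times the rational extension of
`φ_B` is an integral linear map `ψ'` with `ψ' 1 = p` and `ψ' x * ψ' y = p ψ' (x y)`
(`exists_isLift`, `IsLift.map_mul_map`). All products of elements of its image therefore vanish
modulo `p`. Up to sign, the entries of `A` occur as coordinates of `ψ'`, so for primitive `A` the
image contains some `ν` that is nonzero with square zero modulo `p`, and modulo `p` the image is the
line through `ν`. Hence `𝔍_B = C ν + p C`, which is also the left annihilator of `ν` modulo `p`
(`IsLift.mem_extIdeal_iff`). It has index `p²`, and its norms are divisible by `p`. A generating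
matrix `I` thus carries the norm form to `p n'` with `n'` similar to the norm form, and `Υ_A = p
I⁻¹` represents `p n` by `n'` (`exists_isUpsilon`).

Injectivity: the ideal determines `ν` modulo `p` up to a scalar, hence the common direction of the
rows of `A` modulo `p`. As in the theory of neighbouring lattices, this isotropic direction
determines the lattice `B ℤ³` (`IsDual.exists_mul_eq`). So automorphs with the same ideal differ by
an invertible integral matrix, which is automatically an isometry.

Divisibility: if `ψ` is the lift of `A`, then `ψ (r * ψ' z) = p ψ r * z`. Hence `ψ` maps `𝔍_B` into
multiples of `p`, so `Ψ_A I` is divisible by `p` and `Ψ_A` is an integral multiple of `p I⁻¹`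
(`IsUpsilon.dividesPsi`). -/

namespace AutomorphLift

open Matrix

/-! ### Gram matrices of integral quadratic forms -/

/-- The even matrix `(q(eᵢ + eⱼ) - q(eᵢ) - q(eⱼ))ᵢⱼ` of an integral quadratic form. -/
def gram {m : ℕ} (q : QuadraticForm ℤ (Fin m → ℤ)) : Matrix (Fin m) (Fin m) ℤ :=
  Matrix.of fun i j : Fin m => QuadraticMap.polar q (Pi.single i 1) (Pi.single j 1)

theorem formDet_eq_det_gram {m : ℕ} (q : QuadraticForm ℤ (Fin m → ℤ)) :
    formDet q = (gram q).det := rfl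

theorem polar_eq_dotProduct {m : ℕ} (q : QuadraticForm ℤ (Fin m → ℤ)) (x y : Fin m → ℤ) :
    QuadraticMap.polar q x y = x ⬝ᵥ gram q *ᵥ y := by
  have h : gram q = LinearMap.toMatrix₂' ℤ q.polarBilin := by
    ext i j
    simp [gram, LinearMap.toMatrix₂'_apply]
  rw [h, ← Matrix.toLinearMap₂'_apply', Matrix.toLinearMap₂'_toMatrix']
  rfl

theorem polar_mulVec {m n : ℕ} {q : QuadraticForm ℤ (Fin m → ℤ)}
    {q' : QuadraticForm ℤ (Fin n → ℤ)} {A : Matrix (Fin m) (Fin n) ℤ} (hA : A ∈ reps q q')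
    (x y : Fin n → ℤ) :
    QuadraticMap.polar q (A *ᵥ x) (A *ᵥ y) = QuadraticMap.polar q' x y := by
  simp only [QuadraticMap.polar, ← Matrix.mulVec_add, hA _]

theorem transpose_mul_gram_mul {m n : ℕ} {q : QuadraticForm ℤ (Fin m → ℤ)}
    {q' : QuadraticForm ℤ (Fin n → ℤ)} {A : Matrix (Fin m) (Fin n) ℤ} (hA : A ∈ reps q q') :
    Aᵀ * gram q * A = gram q' := by
  ext i j
  have h := polar_mulVec hA (Pi.single i 1) (Pi.single j 1)
  rw [polar_eq_dotProduct] at h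
  change _ = QuadraticMap.polar q' (Pi.single i 1) (Pi.single j 1)
  rw [← h, Matrix.mulVec_single_one, Matrix.mulVec_single_one, Matrix.mul_assoc,
    Matrix.mul_apply']
  rfl

theorem gram_smul {m : ℕ} (c : ℤ) (q : QuadraticForm ℤ (Fin m → ℤ)) :
    gram (c • q) = c • gram q := by
  ext i j
  simp [gram, QuadraticMap.polar, mul_sub]

theorem det_sq_mul_formDet {m : ℕ} {q q' : QuadraticForm ℤ (Fin m → ℤ)}
    {A : Matrix (Fin m) (Fin m) ℤ} (hA : A ∈ reps q q') :
    A.det ^ 2 * formDet q = formDet q' := by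
  rw [formDet_eq_det_gram, formDet_eq_det_gram, ← transpose_mul_gram_mul hA, Matrix.det_mul,
    Matrix.det_mul, Matrix.det_transpose]
  ring

theorem formDet_smul {m : ℕ} (c : ℤ) (q : QuadraticForm ℤ (Fin m → ℤ)) :
    formDet (c • q) = c ^ m * formDet q := by
  rw [formDet_eq_det_gram, gram_smul, Matrix.det_smul, Fintype.card_fin, formDet_eq_det_gram]

/-- A quadratic form whose values are all divisible by `c ≠ 0` is `c` times a quadratic form. -/
theorem exists_eq_smul_of_dvd {M : Type*} [AddCommGroup M] (Q : QuadraticForm ℤ M) {c : ℤ}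
    (hc : c ≠ 0) (h : ∀ x, c ∣ Q x) : ∃ Q' : QuadraticForm ℤ M, Q = c • Q' := by
  choose f hf using h
  have hpol (x y : M) : QuadraticMap.polar Q x y = c * QuadraticMap.polar f x y := by
    simp only [QuadraticMap.polar, hf]; ring
  refine ⟨QuadraticMap.ofPolar f ?_ ?_ ?_, ?_⟩
  · intro a x
    have := Q.map_smul a x
    rw [hf, hf, smul_eq_mul] at this
    exact mul_left_cancel₀ hc (by rw [this, smul_eq_mul]; ring)
  · intro x x' y
    have := Q.polar_add_left x x' y
    rw [hpol, hpol, hpol] at this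
    exact mul_left_cancel₀ hc (by rw [this]; ring)
  · intro a x y
    have := Q.polar_smul_left a x y
    rw [hpol, hpol, smul_eq_mul] at this
    exact mul_left_cancel₀ hc (by rw [this, smul_eq_mul]; ring)
  · ext x
    exact hf x

/-- The dual automorph `p² A⁻¹` of an automorph of ternary forms. -/
theorem exists_dual {q q' : QuadraticForm ℤ (Fin 3 → ℤ)} {p : ℕ} (hp : p.Prime)
    (hq : formDet q ≠ 0) (hpq : ¬ (p : ℤ) ∣ formDet q) (hdet : formDet q' = formDet q)
    {A : Matrix (Fin 3) (Fin 3) ℤ} (hA : A ∈ reps q' ((p : ℤ) ^ 2 • q)) :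
    ∃ B ∈ reps q ((p : ℤ) ^ 2 • q'), ∃ ε : ℤ, ε * ε = 1 ∧
      A * B = (p : ℤ) ^ 2 • (1 : Matrix (Fin 3) (Fin 3) ℤ) ∧
      B * A = (p : ℤ) ^ 2 • (1 : Matrix (Fin 3) (Fin 3) ℤ) ∧
      A.adjugate = (ε * p) • B ∧ gram q * B = Aᵀ * gram q' := by
  have hp0 : (p : ℤ) ≠ 0 := by exact_mod_cast hp.ne_zero
  have hG := transpose_mul_gram_mul hA
  have hd := det_sq_mul_formDet hA
  rw [formDet_smul, hdet] at hd
  have hd' : A.det ^ 2 = ((p : ℤ) ^ 3) ^ 2 := by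
    rw [mul_right_cancel₀ hq hd]; ring
  obtain ⟨ε, hε, hdε⟩ : ∃ ε : ℤ, ε * ε = 1 ∧ A.det = ε * p ^ 3 := by
    rcases sq_eq_sq_iff_eq_or_eq_neg.1 hd' with h | h
    · exact ⟨1, by norm_num, by rw [h]; ring⟩
    · exact ⟨-1, by norm_num, by rw [h]; ring⟩
  -- This is `Aᵀ G' A = p² G` multiplied by the adjugate of `A`, with `det A = ε p³` inserted and
  -- `p²` cancelled.
  have h1 : gram q * A.adjugate = (ε * p) • (Aᵀ * gram q') := by
    have h := congrArg (· * A.adjugate) hG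
    simp only [gram_smul] at h
    rw [Matrix.mul_assoc, Matrix.mul_adjugate, hdε, Matrix.mul_smul, Matrix.mul_one,
      Matrix.smul_mul] at h
    refine smul_right_injective _ (pow_ne_zero 2 hp0) ?_
    simp only [← h, smul_smul]
    congr 1
    ring
  -- The adjugate of the Gram matrix isolates `det q` times the adjugate of `A`, and `det q` is
  -- prime to `p`.
  have h2 : ∀ i j, (p : ℤ) ∣ A.adjugate i j := by
    intro i j
    have h := congrArg (fun X => ((gram q).adjugate * X) i j) h1
    simp only [← Matrix.mul_assoc, Matrix.adjugate_mul, Matrix.mul_smul, Matrix.smul_mul,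
      Matrix.one_mul, Matrix.smul_apply, smul_eq_mul] at h
    have h' : (p : ℤ) ∣ (gram q).det * A.adjugate i j :=
      ⟨ε * ((gram q).adjugate * Aᵀ * gram q') i j, by rw [h]; ring⟩
    exact ((Nat.prime_iff_prime_int.1 hp).dvd_or_dvd h').resolve_left hpq
  choose C hC using h2
  have hC' : A.adjugate = (p : ℤ) • Matrix.of C := by
    ext i j; simp [hC]
  have hadj : A.adjugate = (ε * p) • (ε • Matrix.of C) := by
    rw [hC', smul_smul, mul_right_comm, hε, one_mul]
  have hεp : ε * p ≠ 0 := mul_ne_zero (fun h => by simp [h] at hε) hp0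
  have hAB : A * (ε • Matrix.of C) = (p : ℤ) ^ 2 • (1 : Matrix (Fin 3) (Fin 3) ℤ) := by
    refine smul_right_injective _ hεp ?_
    simp only
    rw [← Matrix.mul_smul, ← hadj, Matrix.mul_adjugate, hdε, smul_smul]
    congr 1; ring
  have hBA : (ε • Matrix.of C) * A = (p : ℤ) ^ 2 • (1 : Matrix (Fin 3) (Fin 3) ℤ) := by
    refine smul_right_injective _ hεp ?_
    simp only
    rw [← Matrix.smul_mul, ← hadj, Matrix.adjugate_mul, hdε, smul_smul]
    congr 1; ring
  refine ⟨ε • Matrix.of C, ?_, ε, hε, hAB, hBA, hadj, ?_⟩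
  · intro X
    have h := hA ((ε • Matrix.of C) *ᵥ X)
    rw [Matrix.mulVec_mulVec, hAB, Matrix.smul_mulVec, Matrix.one_mulVec, QuadraticMap.map_smul,
      _root_.smul_apply] at h
    rw [_root_.smul_apply]
    refine mul_left_cancel₀ (pow_ne_zero 2 hp0) ?_
    simp only [smul_eq_mul] at h ⊢
    rw [← h]; ring
  · refine smul_right_injective _ hεp ?_
    simp only
    rw [← h1, hadj]
    exact (Matrix.mul_smul _ _ _).symm

/-! ### Products of two vectors in the even Clifford algebra -/

section Ternary

variable (q : QuadraticForm ℤ (Fin 3 → ℤ))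

/-- The product of two vectors as an element of the even Clifford algebra. -/
noncomputable def evenMul (u v : Fin 3 → ℤ) : CliffordAlgebra.even q :=
  ⟨CliffordAlgebra.ι q u * CliffordAlgebra.ι q v, CliffordAlgebra.ι_mul_ι_mem_evenOdd_zero q _ _⟩

/-- The scalar coordinate of the product of two vectors with respect to the natural basis. -/
def scalarPart (u v : Fin 3 → ℤ) : ℤ :=
  u 0 * v 0 * q (Pi.single 0 1) + u 1 * v 1 * q (Pi.single 1 1) + u 2 * v 2 * q (Pi.single 2 1)
    + u 1 * v 0 * QuadraticMap.polar q (Pi.single 0 1) (Pi.single 1 1)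
    + u 2 * v 0 * QuadraticMap.polar q (Pi.single 0 1) (Pi.single 2 1)
    + u 2 * v 1 * QuadraticMap.polar q (Pi.single 1 1) (Pi.single 2 1)

/-- The order and signs of the natural basis make the vector part of a product of two vectors their
cross product. This is how cofactor matrices enter the lift. -/
theorem evenMul_eq_sum (u v : Fin 3 → ℤ) :
    evenMul q u v = scalarPart q u v • natBasis q 0 + (u ⨯₃ v) 0 • natBasis q 1
      + (u ⨯₃ v) 1 • natBasis q 2 + (u ⨯₃ v) 2 • natBasis q 3 := by
  refine Subtype.ext ?_
  simp only [natBasis, Module.Basis.mk_apply, natFamily, evenMul, evenProd, ι_eq, cross_apply,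
    scalarPart, Matrix.cons_val]
  push_cast
  simp only [mul_add, add_mul, smul_mul_assoc, mul_smul_comm, vec_sq, vec_comm q 0 1,
    vec_comm q 0 2, vec_comm q 1 2]
  change _ = _ • (1 : CliffordAlgebra q) + _ • (basisVec q 1 * basisVec q 2) +
    _ • -(basisVec q 0 * basisVec q 2) + _ • (basisVec q 0 * basisVec q 1)
  module

theorem natBasis_zero : natBasis q 0 = 1 := by simp [natBasis, natFamily]

theorem natBasis_one : natBasis q 1 = evenMul q (Pi.single 1 1) (Pi.single 2 1) := by
  simp [natBasis, natFamily, evenMul, evenProd, basisVec]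

theorem natBasis_two : natBasis q 2 = -evenMul q (Pi.single 0 1) (Pi.single 2 1) := by
  simp [natBasis, natFamily, evenMul, evenProd, basisVec]

theorem natBasis_three : natBasis q 3 = evenMul q (Pi.single 0 1) (Pi.single 1 1) := by
  simp [natBasis, natFamily, evenMul, evenProd, basisVec]

theorem equivFun_evenMul (u v : Fin 3 → ℤ) :
    (natBasis q).equivFun (evenMul q u v) = Fin.cons (scalarPart q u v) (u ⨯₃ v) := by
  rw [evenMul_eq_sum]
  ext i
  simp only [map_add, map_smul]
  fin_cases i <;> simp <;> rfl

theorem evenMul_mul_swap (u v : Fin 3 → ℤ) :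
    evenMul q u v * evenMul q v u = (q u * q v) • 1 := by
  refine Subtype.ext ?_
  change CliffordAlgebra.ι q u * CliffordAlgebra.ι q v *
    (CliffordAlgebra.ι q v * CliffordAlgebra.ι q u) = (q u * q v) • (1 : CliffordAlgebra q)
  rw [mul_assoc, ← mul_assoc _ _ (CliffordAlgebra.ι q u), CliffordAlgebra.ι_sq_scalar,
    Algebra.left_comm, CliffordAlgebra.ι_sq_scalar, ← map_mul, mul_comm (q v),
    Algebra.algebraMap_eq_smul_one]

theorem evenMul_add_swap (u v : Fin 3 → ℤ) :
    evenMul q u v + evenMul q v u = QuadraticMap.polar q u v • 1 := by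
  refine Subtype.ext ?_
  change CliffordAlgebra.ι q u * CliffordAlgebra.ι q v +
    CliffordAlgebra.ι q v * CliffordAlgebra.ι q u =
      QuadraticMap.polar q u v • (1 : CliffordAlgebra q)
  rw [CliffordAlgebra.ι_mul_ι_add_swap, Algebra.algebraMap_eq_smul_one]

variable {q} in
theorem even_smul_cancel {c : ℤ} (hc : c ≠ 0) {x y : CliffordAlgebra.even q}
    (h : c • x = c • y) : x = y := by
  refine (natBasis q).equivFun.injective (smul_right_injective _ hc ?_)
  simp only [← map_smul, h]

theorem int_smul_one_injective {a c : ℤ} (h : a • (1 : CliffordAlgebra.even q) = c • 1) :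
    a = c := by
  have := congrArg (fun x => (natBasis q).equivFun x 0) h
  simp only [← natBasis_zero, map_smul] at this
  simpa using this

/-! ### The norm form on the even Clifford algebra -/

theorem mul_evenConj (x : CliffordAlgebra.even q) : x * evenConj q x = evenNorm q x • 1 := by
  rw [evenNorm_spec, Algebra.algebraMap_eq_smul_one]

theorem evenConj_mul (x y : CliffordAlgebra.even q) :
    evenConj q (x * y) = evenConj q y * evenConj q x :=
  Subtype.ext (star_mul _ _)

theorem evenConj_add (x y : CliffordAlgebra.even q) :
    evenConj q (x + y) = evenConj q x + evenConj q y :=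
  Subtype.ext (star_add _ _)

theorem evenConj_one : evenConj q 1 = 1 :=
  Subtype.ext (star_one _)

theorem mul_evenConj_add (x y : CliffordAlgebra.even q) :
    x * evenConj q y + y * evenConj q x = QuadraticMap.polar (evenNorm q) x y • 1 := by
  have h := mul_evenConj q (x + y)
  have hx := mul_evenConj q x
  have hy := mul_evenConj q y
  rw [evenConj_add] at h
  rw [QuadraticMap.polar, sub_smul, sub_smul, ← h, ← hx, ← hy]
  noncomm_ring

theorem add_evenConj (x : CliffordAlgebra.even q) :
    x + evenConj q x = QuadraticMap.polar (evenNorm q) x 1 • 1 := by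
  have := mul_evenConj_add q x 1
  rwa [evenConj_one, mul_one, one_mul] at this

/-- The conjugate is an integer minus `x`, so it commutes with `x`. -/
theorem evenConj_mul_self (x : CliffordAlgebra.even q) : evenConj q x * x = evenNorm q x • 1 := by
  have h : evenConj q x = QuadraticMap.polar (evenNorm q) x 1 • 1 - x :=
    eq_sub_of_add_eq' (add_evenConj q x)
  have h' := mul_evenConj q x
  rw [h] at h' ⊢
  rw [← h']
  noncomm_ring

theorem evenNorm_sum (g : Fin 4 → ℤ) : evenNorm q (∑ i, g i • natFamily q i) = normValue q g := by
  refine int_smul_one_injective q ?_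
  rw [← mul_evenConj, mul_conj_natFamily, Algebra.algebraMap_eq_smul_one]

theorem normForm_natBasis_apply (g : Fin 4 → ℤ) : normForm q (natBasis q) g = normValue q g := by
  rw [← evenNorm_sum, normForm, QuadraticMap.basisRepr_apply]
  simp [natBasis]

/-- Verified by expanding both determinants. It transfers the assumption that `p` does not divide
`det q` to the norm form. -/
theorem four_mul_formDet_natBasis : 4 * formDet (normForm q (natBasis q)) = formDet q ^ 2 := by
  have hs (i : Fin 3) : QuadraticMap.polar q (Pi.single i 1) (Pi.single i 1) =
      2 * q (Pi.single i 1) := by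
    rw [QuadraticMap.polar_self, nsmul_eq_mul, Nat.cast_ofNat]
  have h3 : formDet q = Matrix.det (Matrix.of fun i j : Fin 3 =>
      QuadraticMap.polar q (Pi.single i 1) (Pi.single j 1)) := rfl
  have h4 : formDet (normForm q (natBasis q)) = Matrix.det (Matrix.of fun i j : Fin 4 =>
      normValue q (Pi.single i 1 + Pi.single j 1) - normValue q (Pi.single i 1)
        - normValue q (Pi.single j 1)) := by
    simp only [formDet, QuadraticMap.polar, normForm_natBasis_apply]
  rw [h3, h4, Matrix.det_fin_three]
  simp only [Matrix.of_apply, hs, QuadraticMap.polar_comm q (Pi.single 1 1) (Pi.single 0 1),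
    QuadraticMap.polar_comm q (Pi.single 2 1) (Pi.single 0 1),
    QuadraticMap.polar_comm q (Pi.single 2 1) (Pi.single 1 1)]
  simp only [normValue]
  generalize QuadraticMap.polar q (Pi.single 0 1) (Pi.single 1 1) = b12
  generalize QuadraticMap.polar q (Pi.single 0 1) (Pi.single 2 1) = b13
  generalize QuadraticMap.polar q (Pi.single 1 1) (Pi.single 2 1) = b23
  generalize q (Pi.single 0 1) = q1
  generalize q (Pi.single 1 1) = q2
  generalize q (Pi.single 2 1) = q3
  simp [Matrix.det_succ_row_zero, Fin.sum_univ_succ, Fin.succAbove, Pi.single_apply]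
  ring

theorem normForm_apply (b : Module.Basis (Fin 4) ℤ (CliffordAlgebra.even q)) (z : Fin 4 → ℤ) :
    normForm q b z = evenNorm q (b.equivFun.symm z) := by
  rw [normForm, QuadraticMap.basisRepr_apply, Module.Basis.equivFun_symm_apply]

theorem toMatrix_mulVec_eq (b' b : Module.Basis (Fin 4) ℤ (CliffordAlgebra.even q))
    (z : Fin 4 → ℤ) : b'.toMatrix b *ᵥ z = b'.equivFun (b.equivFun.symm z) := by
  have h := Module.Basis.toMatrix_mulVec_repr b b' (b.equivFun.symm z)
  simp only [← Module.Basis.equivFun_apply, LinearEquiv.apply_symm_apply] at h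
  exact h

theorem four_mul_formDet_normForm (b : Module.Basis (Fin 4) ℤ (CliffordAlgebra.even q)) :
    4 * formDet (normForm q b) = formDet q ^ 2 := by
  have h : (natBasis q).toMatrix b ∈ reps (normForm q (natBasis q)) (normForm q b) := by
    intro z
    rw [normForm_apply, normForm_apply]
    congr 1
    rw [LinearEquiv.symm_apply_eq]
    exact toMatrix_mulVec_eq q (natBasis q) b z
  have hu : IsUnit ((natBasis q).toMatrix b).det := by
    rw [← Module.Basis.det_apply]
    exact Module.Basis.isUnit_det _ _
  rw [← det_sq_mul_formDet h, Int.isUnit_sq hu, one_mul, four_mul_formDet_natBasis]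

end Ternary

/-! ### The integral lift of an automorph -/

section Lift

variable {q q' : QuadraticForm ℤ (Fin 3 → ℤ)}

theorem evenMap_evenMul (A : reps q q') (u v : Fin 3 → ℤ) :
    evenMap A (evenMul q' u v) = evenMul q (A.1 *ᵥ u) (A.1 *ᵥ v) := by
  refine Subtype.ext ?_
  change CliffordAlgebra.map (toIsometry A)
    (CliffordAlgebra.ι q' u * CliffordAlgebra.ι q' v) = _
  rw [map_mul, CliffordAlgebra.map_apply_ι, CliffordAlgebra.map_apply_ι]
  rfl

theorem smul_one_mem_reps (c : ℤ) (q : QuadraticForm ℤ (Fin 3 → ℤ)) :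
    c • (1 : Matrix (Fin 3) (Fin 3) ℤ) ∈ reps q (c ^ 2 • q) := by
  intro X
  rw [Matrix.smul_mulVec, Matrix.one_mulVec, QuadraticMap.map_smul, _root_.smul_apply,
    smul_eq_mul, smul_eq_mul]
  ring

/-- The embedding of `C₀(c² q)` as a subring of `C₀(q)`. -/
noncomputable def scaledEmbedding (c : ℤ) (q : QuadraticForm ℤ (Fin 3 → ℤ)) :
    CliffordAlgebra.even (c ^ 2 • q) →ₐ[ℤ] CliffordAlgebra.even q :=
  evenMap ⟨c • (1 : Matrix (Fin 3) (Fin 3) ℤ), smul_one_mem_reps c q⟩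

theorem evenMul_smul_smul (c : ℤ) (u v : Fin 3 → ℤ) :
    evenMul q (c • u) (c • v) = c ^ 2 • evenMul q u v := by
  refine Subtype.ext ?_
  change CliffordAlgebra.ι q (c • u) * CliffordAlgebra.ι q (c • v) =
    c ^ 2 • (CliffordAlgebra.ι q u * CliffordAlgebra.ι q v)
  rw [map_smul, map_smul, smul_mul_assoc, mul_smul_comm, smul_smul, sq]

theorem scaledEmbedding_evenMul (c : ℤ) (u v : Fin 3 → ℤ) :
    scaledEmbedding c q (evenMul (c ^ 2 • q) u v) = c ^ 2 • evenMul q u v := by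
  rw [scaledEmbedding, evenMap_evenMul]
  simp only [Matrix.smul_mulVec, Matrix.one_mulVec]
  exact evenMul_smul_smul c u v

/-- One choice of `a`, `u`, `v` serves all forms, so source and target bases can be treated together
without cases. The sign `a` absorbs the minus in `-e₁e₃`. -/
theorem natBasis_succ (k : Fin 3) :
    ∃ (a : ℤ) (u v : Fin 3 → ℤ), u ⨯₃ v = a • Pi.single k 1 ∧ a * a = 1 ∧
      ∀ q : QuadraticForm ℤ (Fin 3 → ℤ), natBasis q k.succ = a • evenMul q u v := by
  fin_cases k
  · refine ⟨1, Pi.single 1 1, Pi.single 2 1, ?_, by norm_num,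
      fun q => (natBasis_one q).trans (one_smul _ _).symm⟩
    ext i; fin_cases i <;> simp [cross_apply]
  · refine ⟨-1, Pi.single 0 1, Pi.single 2 1, ?_, by norm_num,
      fun q => (natBasis_two q).trans (by rw [neg_smul, one_smul])⟩
    ext i; fin_cases i <;> simp [cross_apply]
  · refine ⟨1, Pi.single 0 1, Pi.single 1 1, ?_, by norm_num,
      fun q => (natBasis_three q).trans (one_smul _ _).symm⟩
    ext i; fin_cases i <;> simp [cross_apply]

theorem scaledEmbedding_natBasis_succ (c : ℤ) (k : Fin 3) :
    scaledEmbedding c q (natBasis (c ^ 2 • q) k.succ) = c ^ 2 • natBasis q k.succ := by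
  obtain ⟨a, u, v, -, -, h⟩ := natBasis_succ k
  rw [h, h, map_smul, scaledEmbedding_evenMul, smul_comm]

theorem exists_scaledEmbedding_eq (c : ℤ) (x : CliffordAlgebra.even q) :
    ∃ y, scaledEmbedding c q y = c ^ 2 • x := by
  -- The embedding multiplies every basis element except the unit by `c²`, so only the unit
  -- coordinate needs the extra factor.
  refine ⟨((natBasis q).repr x 0 * c ^ 2) • natBasis _ 0 +
    ∑ k : Fin 3, (natBasis q).repr x k.succ • natBasis _ k.succ, ?_⟩
  conv_rhs => rw [← (natBasis q).sum_repr x, Fin.sum_univ_succ]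
  simp only [map_add, map_sum, map_smul, scaledEmbedding_natBasis_succ, natBasis_zero, _root_.map_one]
  rw [smul_add, Finset.smul_sum, smul_smul, mul_comm]
  simp only [smul_comm (c ^ 2)]

theorem cross_mulVec (A : Matrix (Fin 3) (Fin 3) ℤ) (u v : Fin 3 → ℤ) :
    (A *ᵥ u) ⨯₃ (A *ᵥ v) = A.adjugateᵀ *ᵥ (u ⨯₃ v) := by
  ext i
  fin_cases i <;>
    simp [Matrix.adjugate_fin_three, cross_apply, Matrix.mulVec, dotProduct,
      Fin.sum_univ_three] <;> ring

/-- `ψ` is the integral map with matrix `Ψ_A`. -/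
structure IsLift (p : ℕ) (A : reps q' ((p : ℤ) ^ 2 • q))
    (ψ : CliffordAlgebra.even q →ₗ[ℤ] CliffordAlgebra.even q') : Prop where
  toMatrix_eq : Psi p A = (LinearMap.toMatrix (natBasis q) (natBasis q') ψ).map Int.cast
  scaledEmbedding_eq : ∀ y, ψ (scaledEmbedding p q y) = (p : ℤ) • evenMap A y

/-- The vector part is a cofactor expression, divisible by assumption. For the scalar part `s`, let
`U = A u` and `V = A v`: then `UV ≡ s` and `VU ≡ -s` modulo `p`, while `UV * VU = q'(U) q'(V)` is
divisible by `p`. So `p` divides `s²`. -/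
theorem dvd_evenMul {p : ℕ} (hp : p.Prime) {A : Matrix (Fin 3) (Fin 3) ℤ}
    (hA : A ∈ reps q' ((p : ℤ) ^ 2 • q)) (hadj : ∀ i j, (p : ℤ) ∣ A.adjugate i j)
    (u v : Fin 3 → ℤ) :
    ∃ y, evenMul q' (A *ᵥ u) (A *ᵥ v) = (p : ℤ) • y := by
  have hc : ∀ i, (p : ℤ) ∣ ((A *ᵥ u) ⨯₃ (A *ᵥ v)) i := by
    intro i
    rw [cross_mulVec, Matrix.mulVec, dotProduct]
    refine Finset.dvd_sum fun j _ => Dvd.dvd.mul_right (hadj j i) _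
  choose c hc using hc
  obtain ⟨w, hw⟩ : ∃ w, evenMul q' (A *ᵥ u) (A *ᵥ v) =
      scalarPart q' (A *ᵥ u) (A *ᵥ v) • (1 : CliffordAlgebra.even q') + (p : ℤ) • w := by
    refine ⟨c 0 • natBasis q' 1 + c 1 • natBasis q' 2 + c 2 • natBasis q' 3, ?_⟩
    rw [evenMul_eq_sum, hc, hc, hc, natBasis_zero]
    module
  have hs : (p : ℤ) ∣ scalarPart q' (A *ᵥ u) (A *ᵥ v) := by
    refine (Nat.prime_iff_prime_int.1 hp).dvd_of_dvd_pow (n := 2) ?_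
    have h1 := evenMul_mul_swap q' (A *ᵥ u) (A *ᵥ v)
    have h2 := evenMul_add_swap q' (A *ᵥ u) (A *ᵥ v)
    rw [polar_mulVec hA] at h2
    rw [hA, hA, eq_sub_of_add_eq' h2, hw] at h1
    generalize scalarPart q' (A *ᵥ u) (A *ᵥ v) = s at h1
    have h3 : s ^ 2 • (1 : CliffordAlgebra.even q') = (p : ℤ) •
      (((p * QuadraticMap.polar q u v * s - p ^ 3 * q u * q v : ℤ)) •
        (1 : CliffordAlgebra.even q')
        + (p ^ 2 * QuadraticMap.polar q u v - 2 * s : ℤ) • w - (p : ℤ) • (w * w)) := by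
      have h4 : QuadraticMap.polar ⇑((p : ℤ) ^ 2 • q) u v = p ^ 2 * QuadraticMap.polar q u v := by
        simp [QuadraticMap.polar, mul_sub]
      rw [h4] at h1
      simp only [mul_sub, add_mul, mul_add, smul_mul_assoc, mul_smul_comm, mul_one, one_mul,
        smul_add, smul_smul, _root_.smul_apply, smul_eq_mul] at h1
      linear_combination (norm := module) -h1
    have h4 := congrArg (fun x => (natBasis q').equivFun x 0) h3
    simp only [← natBasis_zero, map_smul] at h4
    simp only [Pi.smul_apply, smul_eq_mul] at h4
    refine ⟨_, Eq.trans ?_ h4⟩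
    simp
  obtain ⟨s, hs⟩ := hs
  exact ⟨s • 1 + w, by rw [hw, hs]; module⟩

theorem exists_isLift {p : ℕ} (hp : p.Prime) (A : reps q' ((p : ℤ) ^ 2 • q))
    (hadj : ∀ i j, (p : ℤ) ∣ A.1.adjugate i j) : ∃ ψ, IsLift p A ψ := by
  have h (k : Fin 3) : ∃ y, evenMap A (natBasis _ k.succ) = (p : ℤ) • y := by
    obtain ⟨a, u, v, -, -, h⟩ := natBasis_succ k
    obtain ⟨y, hy⟩ := dvd_evenMul hp A.2 hadj u v
    exact ⟨a • y, by rw [h, map_smul, evenMap_evenMul, hy, smul_comm]⟩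
  choose y hy using h
  have hp0 : (p : ℚ) ≠ 0 := by exact_mod_cast hp.ne_zero
  -- Over the rationals this is `p φ_A`: the unit goes to `p`, and each scaled generator contributes
  -- `p⁻¹` times its image under `evenMap A`.
  refine ⟨(natBasis q).constr ℤ (Fin.cons ((p : ℤ) • 1) y), ?_, ?_⟩
  · ext i k
    rw [Psi, Matrix.mul_diagonal, Matrix.map_apply, Matrix.map_apply, Phi,
      LinearMap.toMatrix_apply, LinearMap.toMatrix_apply, Module.Basis.constr_basis]
    refine Fin.cases ?_ (fun k => ?_) k
    · simp only [natBasis_zero, Fin.cons_zero, AlgHom.toLinearMap_apply, _root_.map_one, map_smul,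
        Finsupp.smul_apply, smul_eq_mul, Int.cast_mul, Int.cast_natCast, Matrix.cons_val_zero]
      exact mul_comm _ _
    · simp only [hy, Fin.cons_succ, AlgHom.toLinearMap_apply, map_smul, Finsupp.smul_apply,
        smul_eq_mul, Int.cast_mul, Int.cast_natCast, Matrix.cons_val_succ]
      have : (![(p : ℚ)⁻¹, (p : ℚ)⁻¹, (p : ℚ)⁻¹] : Fin 3 → ℚ) k = (p : ℚ)⁻¹ := by
        fin_cases k <;> rfl
      rw [this]
      field_simp
  · intro x
    refine LinearMap.congr_fun (f := ((natBasis q).constr ℤ (Fin.cons ((p : ℤ) • 1) y)) ∘ₗ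
      (scaledEmbedding p q).toLinearMap) (g := (p : ℤ) • (evenMap A).toLinearMap) ?_ x
    refine (natBasis _).ext fun k => ?_
    refine Fin.cases ?_ (fun k => ?_) k
    · simp only [LinearMap.comp_apply, AlgHom.toLinearMap_apply, natBasis_zero, map_one,
        LinearMap.smul_apply]
      rw [← natBasis_zero q, Module.Basis.constr_basis, Fin.cons_zero]
    · simp only [LinearMap.comp_apply, AlgHom.toLinearMap_apply, LinearMap.smul_apply]
      rw [scaledEmbedding_natBasis_succ, map_smul, Module.Basis.constr_basis, Fin.cons_succ, hy,
        smul_smul, sq]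

/-! ### Multiplicativity and coordinates of the lift -/

namespace IsLift

variable {p : ℕ} {A : reps q' ((p : ℤ) ^ 2 • q)}
  {ψ : CliffordAlgebra.even q →ₗ[ℤ] CliffordAlgebra.even q'}

theorem map_one (h : IsLift p A ψ) : ψ 1 = (p : ℤ) • 1 := by
  have := h.scaledEmbedding_eq 1
  rwa [_root_.map_one (scaledEmbedding _ _), _root_.map_one (evenMap A)] at this

theorem smul_map_evenMul (h : IsLift p A ψ) (hp : p ≠ 0) (u v : Fin 3 → ℤ) :
    (p : ℤ) • ψ (evenMul q u v) = evenMul q' (A.1 *ᵥ u) (A.1 *ᵥ v) := by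
  have hp0 : (p : ℤ) ≠ 0 := by exact_mod_cast hp
  have := h.scaledEmbedding_eq (evenMul _ u v)
  rw [scaledEmbedding_evenMul, evenMap_evenMul, map_smul] at this
  refine even_smul_cancel hp0 ?_
  rw [← this, smul_smul, sq]

/-- Rationally `ψ` is `p` times a ring homomorphism. Multiplying both factors by `p²` moves them
into the embedded subring, where this can be read off. -/
theorem map_mul_map (h : IsLift p A ψ) (hp : p ≠ 0) (x y : CliffordAlgebra.even q) :
    ψ x * ψ y = (p : ℤ) • ψ (x * y) := by
  have hp0 : (p : ℤ) ≠ 0 := by exact_mod_cast hp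
  obtain ⟨x', hx⟩ := exists_scaledEmbedding_eq (p : ℤ) x
  obtain ⟨y', hy⟩ := exists_scaledEmbedding_eq (p : ℤ) y
  refine even_smul_cancel (pow_ne_zero 4 hp0) ?_
  have h1 := h.scaledEmbedding_eq x'
  have h2 := h.scaledEmbedding_eq y'
  have h3 := h.scaledEmbedding_eq (x' * y')
  rw [map_mul (scaledEmbedding _ _), map_mul (evenMap A), hx, hy] at h3
  rw [hx, map_smul] at h1
  rw [hy, map_smul] at h2
  have h4 := congrArg₂ (· * ·) h1 h2
  simp only [smul_mul_assoc, mul_smul_comm, smul_smul, map_smul] at h3 h4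
  calc (p : ℤ) ^ 4 • (ψ x * ψ y) = ((p : ℤ) ^ 2 * p ^ 2) • (ψ x * ψ y) := by ring_nf
    _ = (p : ℤ) • (p : ℤ) • (evenMap A x' * evenMap A y') := by rw [h4, smul_smul]
    _ = (p : ℤ) ^ 4 • (p : ℤ) • ψ (x * y) := by
      rw [← h3, smul_smul, smul_smul]
      ring_nf

theorem mem_liftImage_iff (h : IsLift p A ψ) (x : CliffordAlgebra.even q') :
    x ∈ liftImage p A ↔ ∃ y, ψ y = x := by
  have key (y : CliffordAlgebra.even q) :
      (fun k => ((natBasis q').repr (ψ y) k : ℚ)) =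
        Psi p A *ᵥ fun k => ((natBasis q).repr y k : ℚ) := by
    rw [h.toMatrix_eq]
    ext k
    rw [← LinearMap.toMatrix_mulVec_repr (natBasis q) (natBasis q') ψ y]
    simp [Matrix.mulVec, dotProduct]
  constructor
  · rintro ⟨z, hz⟩
    refine ⟨(natBasis q).equivFun.symm z, ?_⟩
    refine (natBasis q').repr.injective (Finsupp.ext fun k => ?_)
    have h1 := key ((natBasis q).equivFun.symm z)
    simp only [← Module.Basis.equivFun_apply, LinearEquiv.apply_symm_apply] at h1 hz ⊢
    exact_mod_cast congrFun (h1.trans hz.symm) k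
  · rintro ⟨y, rfl⟩
    exact ⟨_, key y⟩

/-- The vector part of `(A u)(A v)` is the cofactor matrix applied to `u ⨯₃ v`. Used with the roles
of an automorph and its dual exchanged, this exhibits the entries of `A` inside the lift of `B`. -/
theorem equivFun_map_succ (h : IsLift p A ψ) (hp : p ≠ 0) {ε : ℤ} {B : Matrix (Fin 3) (Fin 3) ℤ}
    (hadj : A.1.adjugate = (ε * p) • B) (k i : Fin 3) :
    (natBasis q').equivFun (ψ (natBasis q k.succ)) i.succ = ε * B k i := by
  have hp0 : (p : ℤ) ≠ 0 := by exact_mod_cast hp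
  obtain ⟨a, u, v, huv, ha, hk⟩ := natBasis_succ k
  refine mul_left_cancel₀ hp0 ?_
  have h1 := congrArg (fun x => (natBasis q').equivFun x i.succ) (h.smul_map_evenMul hp u v)
  simp only [equivFun_evenMul, Fin.cons_succ, map_smul, cross_mulVec, huv, hadj] at h1
  simp only [Pi.smul_apply, smul_eq_mul, Matrix.mulVec_smul, Matrix.mulVec_single_one,
    Matrix.col_apply, Matrix.transpose_apply, Matrix.smul_apply] at h1
  rw [hk, map_smul, map_smul, Pi.smul_apply, smul_eq_mul]
  linear_combination a * h1 + ε * p * B k i * ha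

end IsLift

theorem IsLift.comp {p : ℕ} (hp : p ≠ 0) {A : reps q' ((p : ℤ) ^ 2 • q)}
    {B : reps q ((p : ℤ) ^ 2 • q')}
    {ψ : CliffordAlgebra.even q →ₗ[ℤ] CliffordAlgebra.even q'}
    {ψ' : CliffordAlgebra.even q' →ₗ[ℤ] CliffordAlgebra.even q}
    (h : IsLift p A ψ) (h' : IsLift p B ψ')
    (hAB : A.1 * B.1 = (p : ℤ) ^ 2 • (1 : Matrix (Fin 3) (Fin 3) ℤ)) :
    ψ ∘ₗ ψ' = (p : ℤ) ^ 2 • LinearMap.id := by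
  have hp0 : (p : ℤ) ≠ 0 := by exact_mod_cast hp
  refine (natBasis _).ext fun k => ?_
  refine Fin.cases ?_ (fun k => ?_) k
  · rw [natBasis_zero, LinearMap.comp_apply, h'.map_one, map_smul, h.map_one, smul_smul, sq]
    rfl
  · obtain ⟨a, u, v, -, -, hk⟩ := natBasis_succ k
    rw [hk, map_smul, map_smul]
    congr 1
    refine even_smul_cancel (pow_ne_zero 2 hp0) ?_
    rw [LinearMap.comp_apply, sq, mul_smul, ← map_smul ψ, h'.smul_map_evenMul hp,
      h.smul_map_evenMul hp, Matrix.mulVec_mulVec, Matrix.mulVec_mulVec, hAB, Matrix.smul_mulVec,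
      Matrix.smul_mulVec, Matrix.one_mulVec, Matrix.one_mulVec, evenMul_smul_smul,
      LinearMap.smul_apply, LinearMap.id_apply, smul_smul]
    congr 1
    ring

theorem psi_mul_psi {p : ℕ} (hp : p ≠ 0) {A : reps q' ((p : ℤ) ^ 2 • q)}
    {B : reps q ((p : ℤ) ^ 2 • q')}
    {ψ : CliffordAlgebra.even q →ₗ[ℤ] CliffordAlgebra.even q'}
    {ψ' : CliffordAlgebra.even q' →ₗ[ℤ] CliffordAlgebra.even q}
    (h : IsLift p A ψ) (h' : IsLift p B ψ')
    (hAB : A.1 * B.1 = (p : ℤ) ^ 2 • (1 : Matrix (Fin 3) (Fin 3) ℤ)) :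
    Psi p A * Psi p B = (p : ℚ) ^ 2 • (1 : Matrix (Fin 4) (Fin 4) ℚ) := by
  have h1 := LinearMap.toMatrix_comp (natBasis q') (natBasis q) (natBasis q') ψ ψ'
  rw [h.comp hp h' hAB, map_smul, LinearMap.toMatrix_id] at h1
  rw [h.toMatrix_eq, h'.toMatrix_eq]
  have h2 := Matrix.map_mul (L := LinearMap.toMatrix (natBasis q) (natBasis q') ψ)
    (M := LinearMap.toMatrix (natBasis q') (natBasis q) ψ') (f := Int.castRingHom ℚ)
  rw [← h1] at h2
  refine h2.symm.trans ?_
  ext i j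
  simp only [Matrix.map_apply, Matrix.smul_apply, Matrix.one_apply, smul_eq_mul]
  split_ifs <;> simp

end Lift

/-! ### Reduction modulo a prime -/

/-- Lets congruences modulo `p` be argued as equalities in a ring, of which only surjectivity and
the kernel of `π` matter. -/
theorem exists_reduction.{u} (R : Type u) [Ring R] (p : ℕ) :
    ∃ (S : Type u) (_ : Ring S) (π : R →+* S), Function.Surjective π ∧
      ∀ x, π x = 0 ↔ ∃ w, x = (p : ℤ) • w := by
  have : (Ideal.span {(p : R)}).IsTwoSided := by
    refine ⟨fun b ha => ?_⟩
    obtain ⟨c, rfl⟩ := Ideal.mem_span_singleton'.1 ha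
    exact Ideal.mem_span_singleton'.2
      ⟨c * b, by rw [mul_assoc, mul_assoc, (Nat.cast_commute p b).eq]⟩
  refine ⟨R ⧸ Ideal.span {(p : R)}, inferInstance, Ideal.Quotient.mk _,
    Ideal.Quotient.mk_surjective, fun x => ?_⟩
  rw [Ideal.Quotient.eq_zero_iff_mem, Ideal.mem_span_singleton']
  refine exists_congr fun w => ?_
  rw [zsmul_eq_mul, Int.cast_natCast, (Nat.cast_commute p w).eq, eq_comm]

theorem exists_int_smul_eq {p : ℕ} (hp : p.Prime) {a : ℤ} (ha : ¬ (p : ℤ) ∣ a) :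
    ∃ c e : ℤ, c * a = 1 + e * p := by
  obtain ⟨u, v, h⟩ := ((Nat.prime_iff_prime_int.1 hp).coprime_iff_not_dvd.2 ha)
  exact ⟨v, -u, by linear_combination h⟩

/-- `G` is invertible modulo `p`; the adjugate replaces its inverse. -/
theorem exists_not_dvd_mulVec {n p : ℕ} (hp : p.Prime) {G : Matrix (Fin n) (Fin n) ℤ}
    (hG : ¬ (p : ℤ) ∣ G.det) {z : Fin n → ℤ} (hz : ∃ i, ¬ (p : ℤ) ∣ z i) :
    ∃ i, ¬ (p : ℤ) ∣ (G *ᵥ z) i := by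
  by_contra! h
  obtain ⟨i, hi⟩ := hz
  have h1 : (p : ℤ) ∣ (G.adjugate *ᵥ (G *ᵥ z)) i := by
    rw [Matrix.mulVec, dotProduct]
    exact Finset.dvd_sum fun j _ => Dvd.dvd.mul_left (h j) _
  rw [Matrix.mulVec_mulVec, Matrix.adjugate_mul, Matrix.smul_mulVec, Matrix.one_mulVec,
    Pi.smul_apply, smul_eq_mul] at h1
  exact ((Nat.prime_iff_prime_int.1 hp).dvd_or_dvd h1).elim hG hi

/-! ### Annihilators of an element in an abstract ring -/

section Nilpotent

variable {S : Type*} [Ring S] {ν d d' x : S}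

/-- Multiply the relation on the left by `x`. It says that the left annihilator of `ν` lies in the
left ideal generated by `ν`. -/
theorem eq_neg_mul_mul_of_mul_eq_zero (h : ν * d - d' * ν = 1) (hx : x * ν = 0) :
    x = -(x * d') * ν := by
  have h1 : x * (ν * d - d' * ν) = x := by rw [h, mul_one]
  rw [mul_sub, ← mul_assoc, hx, zero_mul, zero_sub, ← mul_assoc] at h1
  rw [neg_mul, h1]

/-- Using the relation on both sides gives `x = -ν (d x d') ν`, and such a sandwich is a multiple of
`ν`. -/
theorem eq_zsmul_of_mul_eq_zero (h : ν * d - d' * ν = 1)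
    (hν : ∀ c, ∃ t : ℤ, ν * c * ν = t • ν) (hx : x * ν = 0) (hx' : ν * x = 0) :
    ∃ t : ℤ, x = t • ν := by
  have h1 : (ν * d - d' * ν) * x = x := by rw [h, one_mul]
  rw [sub_mul, mul_assoc d', hx', mul_zero, sub_zero] at h1
  obtain ⟨t, ht⟩ := hν (d * (x * d'))
  refine ⟨-t, ?_⟩
  rw [neg_smul, ← ht]
  conv_lhs => rw [← h1, eq_neg_mul_mul_of_mul_eq_zero h hx]
  noncomm_ring

end Nilpotent

/-! ### Nilpotent elements of the even Clifford algebra modulo a prime -/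

section Ternary

variable {q : QuadraticForm ℤ (Fin 3 → ℤ)} {p : ℕ}

/-- `ν` is nonzero with square zero modulo `p`. -/
structure IsNilpotentMod (p : ℕ) (ν : CliffordAlgebra.even q) : Prop where
  ne_zero : ¬ ∃ w, ν = (p : ℤ) • w
  sq_eq : ∃ w, ν * ν = (p : ℤ) • w

theorem exists_eq_smul_of_forall_dvd (b : Module.Basis (Fin 4) ℤ (CliffordAlgebra.even q))
    {c : ℤ} {x : CliffordAlgebra.even q} (h : ∀ i, c ∣ b.equivFun x i) : ∃ w, x = c • w := by
  choose f hf using h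
  refine ⟨b.equivFun.symm f, b.equivFun.injective ?_⟩
  ext i
  rw [map_smul, LinearEquiv.apply_symm_apply, hf]
  rfl

theorem dvd_of_smul_eq_smul (hp : p.Prime) {ν : CliffordAlgebra.even q}
    (hν : ¬ ∃ w, ν = (p : ℤ) • w) {a : ℤ} (h : ∃ w, a • ν = (p : ℤ) • w) : (p : ℤ) ∣ a := by
  by_contra ha
  obtain ⟨c, e, hc⟩ := exists_int_smul_eq hp ha
  obtain ⟨w, hw⟩ := h
  refine hν ⟨c • w - e • ν, ?_⟩
  have : c • a • ν = c • (p : ℤ) • w := by rw [hw]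
  rw [smul_smul, hc] at this
  linear_combination (norm := module) this

/-- If `x ν ≡ 0` with `ν ≢ 0` then the norm of `x` is divisible by `p`. -/
theorem dvd_evenNorm_of_mul (hp : p.Prime) {ν x : CliffordAlgebra.even q}
    (hν : ¬ ∃ w, ν = (p : ℤ) • w) (hx : ∃ w, x * ν = (p : ℤ) • w) :
    (p : ℤ) ∣ evenNorm q x := by
  refine dvd_of_smul_eq_smul hp hν ?_
  obtain ⟨w, hw⟩ := hx
  refine ⟨evenConj q x * w, ?_⟩
  rw [← mul_smul_comm, ← hw, ← mul_assoc, evenConj_mul_self, smul_mul_assoc, one_mul]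

namespace IsNilpotentMod

variable {ν : CliffordAlgebra.even q}

/-- Both terms `ν²` and `ν ν̄` of the quadratic equation of `ν` vanish modulo `p`, leaving trace
times `ν`, where `ν` is nonzero. -/
theorem dvd_trace (hν : IsNilpotentMod p ν) (hp : p.Prime) :
    (p : ℤ) ∣ QuadraticMap.polar (evenNorm q) ν 1 := by
  refine dvd_of_smul_eq_smul hp hν.ne_zero ?_
  obtain ⟨n, hn⟩ := dvd_evenNorm_of_mul hp hν.ne_zero hν.sq_eq
  obtain ⟨w, hw⟩ := hν.sq_eq
  have h1 := mul_evenConj q ν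
  rw [eq_sub_of_add_eq' (add_evenConj q ν), hn, mul_sub, hw, mul_smul_comm, mul_one] at h1
  refine ⟨w + n • 1, ?_⟩
  linear_combination (norm := module) h1

/-- Trace zero gives `ν̄ ≡ -ν`, so the polar form of `x` and `ν` is `ν x̄ - x ν` modulo `p`.
Nondegeneracy of the norm form supplies a basis element `x` for which it is a unit. -/
theorem exists_mul_sub_mul (hν : IsNilpotentMod p ν) (hp : p.Prime)
    (hpq : ¬ (p : ℤ) ∣ formDet q) :
    ∃ d d' w, ν * d - d' * ν = 1 + (p : ℤ) • w := by
  have hG : ¬ (p : ℤ) ∣ (gram (normForm q (natBasis q))).det := by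
    intro h
    have h4 := four_mul_formDet_natBasis q
    exact hpq ((Nat.prime_iff_prime_int.1 hp).dvd_of_dvd_pow (h4 ▸ Dvd.dvd.mul_left h 4))
  have hz : ∃ i, ¬ (p : ℤ) ∣ (natBasis q).equivFun ν i := by
    by_contra! h
    exact hν.ne_zero (exists_eq_smul_of_forall_dvd (natBasis q) h)
  obtain ⟨i, hi⟩ := exists_not_dvd_mulVec hp hG hz
  have h1 : (gram (normForm q (natBasis q)) *ᵥ (natBasis q).equivFun ν) i =
      QuadraticMap.polar (evenNorm q) (natBasis q i) ν := by
    have h := polar_eq_dotProduct (normForm q (natBasis q)) (Pi.single i 1)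
      ((natBasis q).equivFun ν)
    rw [single_dotProduct, one_mul] at h
    rw [← h]
    simp only [QuadraticMap.polar, normForm_apply, map_add, LinearEquiv.symm_apply_apply]
    rw [show (natBasis q).equivFun.symm (Pi.single i 1) = natBasis q i by
      simp [Module.Basis.equivFun_symm_apply, Pi.single_apply]]
  rw [h1] at hi
  obtain ⟨c, e, hc⟩ := exists_int_smul_eq hp hi
  obtain ⟨t, ht⟩ := hν.dvd_trace hp
  have h2 := mul_evenConj_add q (natBasis q i) ν
  rw [eq_sub_of_add_eq' (add_evenConj q ν), ht, mul_sub, mul_smul_comm, mul_one] at h2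
  refine ⟨c • evenConj q (natBasis q i), c • natBasis q i,
    e • 1 - (c * t) • natBasis q i, ?_⟩
  have h3 := congrArg (c • ·) h2
  simp only [smul_smul, hc] at h3
  rw [mul_smul_comm, smul_mul_assoc]
  linear_combination (norm := module) h3

/-- `ν c + c̄ ν̄` is an integer and `ν̄ ≡ -ν`; multiplying by `ν` on the right kills the conjugate
term. -/
theorem exists_mul_mul_eq (hν : IsNilpotentMod p ν) (hp : p.Prime)
    (c : CliffordAlgebra.even q) : ∃ (t : ℤ) (w : _), ν * c * ν = t • ν + (p : ℤ) • w := by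
  obtain ⟨t, ht⟩ := hν.dvd_trace hp
  obtain ⟨w, hw⟩ := hν.sq_eq
  have h := add_evenConj q (ν * c)
  rw [evenConj_mul, eq_sub_of_add_eq' (add_evenConj q ν), ht] at h
  have h1 := congrArg (· * ν) h
  simp only [mul_sub, add_mul, sub_mul, mul_smul_comm, smul_mul_assoc, mul_one, one_mul,
    mul_assoc, hw] at h1
  refine ⟨QuadraticMap.polar (evenNorm q) (ν * c) 1,
    evenConj q c * w - t • (evenConj q c * ν), ?_⟩
  rw [mul_assoc]
  linear_combination (norm := module) h1

theorem exists_eq_mul_add (hν : IsNilpotentMod p ν) (hp : p.Prime)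
    (hpq : ¬ (p : ℤ) ∣ formDet q) {x : CliffordAlgebra.even q}
    (hx : ∃ w, x * ν = (p : ℤ) • w) : ∃ c w, x = c * ν + (p : ℤ) • w := by
  obtain ⟨S, _, π, hsurj, hker⟩ := exists_reduction (CliffordAlgebra.even q) p
  have hk (w) : π ((p : ℤ) • w) = 0 := (hker _).2 ⟨w, rfl⟩
  obtain ⟨d, d', w, hd⟩ := hν.exists_mul_sub_mul hp hpq
  have h1 := congrArg π hd
  rw [map_add, hk, add_zero, map_one, map_sub, map_mul, map_mul] at h1
  have h2 := eq_neg_mul_mul_of_mul_eq_zero h1 (x := π x) (by rw [← map_mul, hker]; exact hx)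
  rw [← map_mul, ← map_neg, ← map_mul, ← sub_eq_zero, ← map_sub, hker] at h2
  obtain ⟨w, hw⟩ := h2
  exact ⟨_, w, eq_add_of_sub_eq' hw⟩

theorem exists_eq_smul_add (hν : IsNilpotentMod p ν) (hp : p.Prime)
    (hpq : ¬ (p : ℤ) ∣ formDet q) {x : CliffordAlgebra.even q}
    (hx : ∃ w, x * ν = (p : ℤ) • w) (hx' : ∃ w, ν * x = (p : ℤ) • w) :
    ∃ (t : ℤ) (w : _), x = t • ν + (p : ℤ) • w := by
  obtain ⟨S, _, π, hsurj, hker⟩ := exists_reduction (CliffordAlgebra.even q) p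
  have hk (w) : π ((p : ℤ) • w) = 0 := (hker _).2 ⟨w, rfl⟩
  obtain ⟨d, d', w, hd⟩ := hν.exists_mul_sub_mul hp hpq
  have h1 := congrArg π hd
  rw [map_add, hk, add_zero, map_one, map_sub, map_mul, map_mul] at h1
  have h3 (c : S) : ∃ t : ℤ, π ν * c * π ν = t • π ν := by
    obtain ⟨c, rfl⟩ := hsurj c
    obtain ⟨t, w, h⟩ := hν.exists_mul_mul_eq hp c
    exact ⟨t, by rw [← map_mul, ← map_mul, h, map_add, hk, add_zero, map_zsmul]⟩
  obtain ⟨t, h2⟩ := eq_zsmul_of_mul_eq_zero h1 h3 (x := π x)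
    (by rw [← map_mul, hker]; exact hx) (by rw [← map_mul, hker]; exact hx')
  rw [← map_zsmul, ← sub_eq_zero, ← map_sub, hker] at h2
  obtain ⟨w, hw⟩ := h2
  exact ⟨t, w, eq_add_of_sub_eq' hw⟩

/-- The left annihilator of `ν` modulo `p` has index `p²`. -/
theorem index_sq_eq (hν : IsNilpotentMod p ν) (hp : p.Prime)
    (hpq : ¬ (p : ℤ) ∣ formDet q) {J : AddSubgroup (CliffordAlgebra.even q)}
    (hJ : ∀ x, x ∈ J ↔ ∃ w, x * ν = (p : ℤ) • w) : J.index ^ 2 = (p ^ 2) ^ 2 := by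
  have : Module.Free ℤ (CliffordAlgebra.even q) := Module.Free.of_basis (natBasis q)
  have : Module.Finite ℤ (CliffordAlgebra.even q) := Module.Finite.of_basis (natBasis q)
  let P : AddSubgroup (CliffordAlgebra.even q) := (nsmulAddMonoidHom p).range
  have hP (x : CliffordAlgebra.even q) : x ∈ P ↔ ∃ w, x = (p : ℤ) • w := by
    refine exists_congr fun w => ?_
    rw [nsmulAddMonoidHom_apply, natCast_zsmul, eq_comm]
  have hPi : P.index = p ^ 4 := by
    have := AddSubgroup.index_range_nsmul (M := CliffordAlgebra.even q) p
    rwa [Module.finrank_eq_card_basis (natBasis q), Fintype.card_fin] at this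
  let f : CliffordAlgebra.even q →+ CliffordAlgebra.even q := AddMonoidHom.mulRight ν
  have h1 : J = P.comap f := by
    ext x
    rw [hJ, AddSubgroup.mem_comap, hP]
    rfl
  -- Modulo `p`, right multiplication by `ν` has equal kernel and image.
  have h2 : J = P ⊔ f.range := by
    apply le_antisymm
    · intro x hx
      obtain ⟨c, w, h⟩ := hν.exists_eq_mul_add hp hpq ((hJ x).1 hx)
      rw [h]
      exact add_mem (AddSubgroup.mem_sup_right ⟨c, rfl⟩)
        (AddSubgroup.mem_sup_left ((hP _).2 ⟨w, rfl⟩))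
    · refine sup_le (fun x hx => ?_) ?_
      · obtain ⟨w, rfl⟩ := (hP x).1 hx
        exact (hJ _).2 ⟨w * ν, smul_mul_assoc _ _ _⟩
      · rintro _ ⟨c, rfl⟩
        obtain ⟨w, hw⟩ := hν.sq_eq
        refine (hJ _).2 ⟨c * w, ?_⟩
        change c * ν * ν = _
        rw [mul_assoc, hw, mul_smul_comm]
  -- The quotient by the kernel is isomorphic to the image, so the index of `J` occurs twice in the
  -- factorization of `p⁴`.
  have h3 : J.index = P.relIndex J := by
    conv_lhs => rw [h1]
    rw [h2, AddSubgroup.index_comap, sup_comm, AddSubgroup.relIndex_sup_right]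
  have h4 := AddSubgroup.relIndex_mul_index (show P ≤ J from h2 ▸ le_sup_left)
  rw [hPi, ← h3] at h4
  rw [sq, h4]
  ring

end IsNilpotentMod

end Ternary

/-! ### Automorphs with the same rows modulo a prime -/

section Rows

theorem exists_eq_smul_of_mulVec_eq_smul {n p : ℕ} (hp : p.Prime) {G : Matrix (Fin n) (Fin n) ℤ}
    (hG : ¬ (p : ℤ) ∣ G.det) {z w : Fin n → ℤ} (h : G *ᵥ z = (p : ℤ) • w) :
    ∃ w', z = (p : ℤ) • w' := by
  have h1 : ∀ i, (p : ℤ) ∣ z i := by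
    by_contra! hz
    obtain ⟨i, hi⟩ := exists_not_dvd_mulVec hp hG hz
    exact hi (by rw [h]; exact ⟨w i, rfl⟩)
  choose f hf using h1
  exact ⟨f, funext hf⟩

theorem exists_eq_sq_smul_of_smul_eq {n p : ℕ} (hp : p.Prime) {a : ℤ} (ha : ¬ (p : ℤ) ∣ a)
    {z w : Fin n → ℤ} (h : a • z = (p : ℤ) ^ 2 • w) : ∃ w', z = (p : ℤ) ^ 2 • w' := by
  have hc : IsCoprime ((p : ℤ) ^ 2) a :=
    ((Nat.prime_iff_prime_int.1 hp).coprime_iff_not_dvd.2 ha).pow_left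
  have h1 : ∀ i, (p : ℤ) ^ 2 ∣ z i := fun i =>
    hc.dvd_of_dvd_mul_left ⟨w i, congrFun h i⟩
  choose f hf using h1
  exact ⟨f, funext hf⟩

variable {q q' q'' : QuadraticForm ℤ (Fin 3 → ℤ)} {p : ℕ}

theorem polar_smul_form (c : ℤ) (u v : Fin 3 → ℤ) :
    QuadraticMap.polar ⇑(c • q) u v = c * QuadraticMap.polar q u v := by
  simp [QuadraticMap.polar, mul_sub]

/-- `B = p² A⁻¹`, together with the adjunction formulas. -/
structure IsDual (p : ℕ) (A : reps q' ((p : ℤ) ^ 2 • q)) (B : reps q ((p : ℤ) ^ 2 • q')) :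
    Prop where
  mul_eq : A.1 * B.1 = (p : ℤ) ^ 2 • (1 : Matrix (Fin 3) (Fin 3) ℤ)
  mul_eq' : B.1 * A.1 = (p : ℤ) ^ 2 • (1 : Matrix (Fin 3) (Fin 3) ℤ)
  gram_mul : gram q * B.1 = A.1ᵀ * gram q'

/-- The rows of `A` are multiples of `u` modulo `p`. -/
def RowsMod (p : ℕ) (u : Fin 3 → ℤ) (A : Matrix (Fin 3) (Fin 3) ℤ) : Prop :=
  ∃ (c : Fin 3 → ℤ) (E : Matrix (Fin 3) (Fin 3) ℤ), A = Matrix.vecMulVec c u + (p : ℤ) • E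

theorem RowsMod.mulVec {u w : Fin 3 → ℤ} {A : Matrix (Fin 3) (Fin 3) ℤ} (hA : RowsMod p u A)
    (hw : (p : ℤ) ∣ w ⬝ᵥ u) : ∃ y, A *ᵥ w = (p : ℤ) • y := by
  obtain ⟨c, E, rfl⟩ := hA
  obtain ⟨t, ht⟩ := hw
  refine ⟨t • c + E *ᵥ w, ?_⟩
  rw [Matrix.add_mulVec, Matrix.smul_mulVec, Matrix.vecMulVec_mulVec, op_smul_eq_smul,
    dotProduct_comm, ht, smul_add, smul_smul]

theorem RowsMod.transpose_mulVec {u : Fin 3 → ℤ} {A : Matrix (Fin 3) (Fin 3) ℤ}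
    (hA : RowsMod p u A) (y : Fin 3 → ℤ) :
    ∃ (a : ℤ) (w : Fin 3 → ℤ), Aᵀ *ᵥ y = a • u + (p : ℤ) • w := by
  obtain ⟨c, E, rfl⟩ := hA
  refine ⟨c ⬝ᵥ y, Eᵀ *ᵥ y, ?_⟩
  rw [Matrix.transpose_add, Matrix.transpose_smul, Matrix.add_mulVec, Matrix.smul_mulVec,
    Matrix.transpose_vecMulVec, Matrix.vecMulVec_mulVec]
  simp

theorem dvd_dotProduct_of_polar (hp : p.Prime) {u v w s : Fin 3 → ℤ} {a : ℤ}
    (ha : ¬ (p : ℤ) ∣ a) (hv : gram q *ᵥ v = a • u + (p : ℤ) • s)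
    (h : (p : ℤ) ∣ QuadraticMap.polar q w v) : (p : ℤ) ∣ w ⬝ᵥ u := by
  rw [polar_eq_dotProduct, hv, dotProduct_add, dotProduct_smul, dotProduct_smul, smul_eq_mul,
    smul_eq_mul] at h
  exact ((Nat.prime_iff_prime_int.1 hp).dvd_or_dvd
    ((dvd_add_left (Dvd.intro _ rfl)).1 h)).resolve_left ha

/-- A vector of the image lattice of `B` not orthogonal to the lattice modulo `p`. -/
theorem IsDual.exists_vector (hp : p.Prime) {A : reps q' ((p : ℤ) ^ 2 • q)}
    {B : reps q ((p : ℤ) ^ 2 • q')} (h : IsDual p A B) (hpq' : ¬ (p : ℤ) ∣ formDet q')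
    (hprim : ∃ k i, ¬ (p : ℤ) ∣ A.1 k i) {u : Fin 3 → ℤ} (hu : RowsMod p u A.1) :
    ∃ (z : Fin 3 → ℤ) (a : ℤ) (s : Fin 3 → ℤ), ¬ (p : ℤ) ∣ a ∧
      gram q *ᵥ (B.1 *ᵥ z) = a • u + (p : ℤ) • s := by
  obtain ⟨k, i, hki⟩ := hprim
  obtain ⟨a, s, has⟩ := hu.transpose_mulVec
    (gram q' *ᵥ ((gram q').adjugate *ᵥ Pi.single k 1))
  -- The adjugate makes `Aᵀ G' z` equal to `det q'` times row `k` of `A`, which is nonzero modulo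
  -- `p`.
  refine ⟨(gram q').adjugate *ᵥ Pi.single k 1, a, s, fun ha => ?_, ?_⟩
  · have h1 := congrFun has i
    rw [Matrix.mulVec_mulVec (Pi.single k 1), Matrix.mul_adjugate, Matrix.smul_mulVec, Matrix.one_mulVec,
      Matrix.mulVec_smul, Matrix.mulVec_single_one] at h1
    simp only [Pi.smul_apply, Pi.add_apply, smul_eq_mul, Matrix.col_apply,
      Matrix.transpose_apply] at h1
    have h2 : (p : ℤ) ∣ (gram q').det * A.1 k i := by
      rw [h1]
      exact dvd_add (Dvd.dvd.mul_right ha _) (Dvd.intro _ rfl)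
    exact ((Nat.prime_iff_prime_int.1 hp).dvd_or_dvd h2).elim hpq' hki
  · rw [← has, Matrix.mulVec_mulVec, h.gram_mul, ← Matrix.mulVec_mulVec]

/-- Modulo `p`, the Gram matrix sends both lattices `B ℤ³` and `B' ℤ³` into the line of `u`, so the
lattices reduce to the same line. Since `q` takes values divisible by `p²` on each, vectors on this
line can be compared modulo `p²`: the discrepancy `p w` has `w` orthogonal to the line, so `A'`
sends `w` to a multiple of `p`. Thus `B ℤ³` lies in `B' ℤ³`. -/
theorem IsDual.exists_mul_eq (hp : p.Prime) {A : reps q' ((p : ℤ) ^ 2 • q)}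
    {B : reps q ((p : ℤ) ^ 2 • q')} (h : IsDual p A B)
    {A' : reps q'' ((p : ℤ) ^ 2 • q)} {B' : reps q ((p : ℤ) ^ 2 • q'')} (h' : IsDual p A' B')
    (hpq : ¬ (p : ℤ) ∣ formDet q) (hpq' : ¬ (p : ℤ) ∣ formDet q')
    (hpq'' : ¬ (p : ℤ) ∣ formDet q'')
    (hA : ∃ k i, ¬ (p : ℤ) ∣ A.1 k i) (hA' : ∃ k i, ¬ (p : ℤ) ∣ A'.1 k i) {u : Fin 3 → ℤ}
    (hu : RowsMod p u A.1) (hu' : RowsMod p u A'.1) :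
    ∃ V : Matrix (Fin 3) (Fin 3) ℤ, A'.1 * B.1 = (p : ℤ) ^ 2 • V := by
  have hpi := Nat.prime_iff_prime_int.1 hp
  have hp0 : (p : ℤ) ≠ 0 := hpi.ne_zero
  obtain ⟨z, a, s, ha, hz⟩ := h.exists_vector hp hpq' hA hu
  obtain ⟨z', a', s', ha', hz'⟩ := h'.exists_vector hp hpq'' hA' hu'
  set v := B.1 *ᵥ z with hv
  set v' := B'.1 *ᵥ z' with hv'
  have hqv : q v = p ^ 2 * q' z := B.2 z
  have hqv' : q v' = p ^ 2 * q'' z' := B'.2 z'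
  have hAv' : A'.1 *ᵥ v' = (p : ℤ) ^ 2 • z' := by
    rw [hv', Matrix.mulVec_mulVec, h'.mul_eq, Matrix.smul_mulVec, Matrix.one_mulVec]
  obtain ⟨w, hw⟩ := exists_eq_smul_of_mulVec_eq_smul hp hpq (z := a' • v - a • v')
    (w := a' • s - a • s') (by
      change gram q *ᵥ _ = _
      rw [Matrix.mulVec_sub, Matrix.mulVec_smul, Matrix.mulVec_smul, hz, hz']
      module)
  have hw' : a' • v = a • v' + (p : ℤ) • w := eq_add_of_sub_eq' hw
  -- Applying `q` to `a' v = a v' + p w`, every term except the cross term is visibly divisible by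
  -- `p²`.
  have h1 : (p : ℤ) ∣ QuadraticMap.polar q w v' := by
    have h2 := congrArg q hw'
    rw [QuadraticMap.map_add q, QuadraticMap.map_smul, QuadraticMap.map_smul,
      QuadraticMap.map_smul, QuadraticMap.polar_smul_left, QuadraticMap.polar_smul_right,
      hqv, hqv', QuadraticMap.polar_comm] at h2
    simp only [smul_eq_mul] at h2
    have h3 : a * QuadraticMap.polar q w v' =
        p * (a' * a' * q' z - a * a * q'' z' - q w) := by
      refine mul_left_cancel₀ hp0 ?_
      linear_combination -h2
    exact (hpi.dvd_or_dvd (Dvd.intro _ h3.symm)).resolve_left ha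
  obtain ⟨y, hy⟩ := hu'.mulVec (dvd_dotProduct_of_polar hp ha' hz' h1)
  obtain ⟨r, hr⟩ := exists_eq_sq_smul_of_smul_eq hp ha' (z := A'.1 *ᵥ v) (w := a • z' + y) (by
    rw [← Matrix.mulVec_smul, hw', Matrix.mulVec_add, Matrix.mulVec_smul, Matrix.mulVec_smul,
      hAv', hy]
    module)
  -- Any other vector of `B ℤ³` is compared with `v` in the same way, now through its polar form
  -- with `v`, which is also divisible by `p²`.
  have key (x : Fin 3 → ℤ) : ∃ g, A'.1 *ᵥ (B.1 *ᵥ x) = (p : ℤ) ^ 2 • g := by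
    obtain ⟨m, t, hm⟩ := hu.transpose_mulVec (gram q' *ᵥ x)
    rw [Matrix.mulVec_mulVec, ← h.gram_mul, ← Matrix.mulVec_mulVec] at hm
    obtain ⟨w, hw⟩ := exists_eq_smul_of_mulVec_eq_smul hp hpq (z := a • (B.1 *ᵥ x) - m • v)
      (w := a • t - m • s) (by
        change gram q *ᵥ _ = _
        rw [Matrix.mulVec_sub, Matrix.mulVec_smul, Matrix.mulVec_smul, hz, hm]
        module)
    have hw' : a • (B.1 *ᵥ x) = m • v + (p : ℤ) • w := eq_add_of_sub_eq' hw
    have h1 : (p : ℤ) ∣ QuadraticMap.polar q w v := by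
      have h2 := congrArg (fun x => QuadraticMap.polar q x v) hw'
      simp only [QuadraticMap.polar_add_left, QuadraticMap.polar_smul_left, smul_eq_mul,
        QuadraticMap.polar_self, hqv] at h2
      rw [hv, polar_mulVec B.2, polar_smul_form, ← hv, nsmul_eq_mul] at h2
      refine ⟨a * QuadraticMap.polar q' x z - 2 * m * q' z, mul_left_cancel₀ hp0 ?_⟩
      push_cast at h2
      linear_combination -h2
    obtain ⟨y, hy⟩ := hu'.mulVec (dvd_dotProduct_of_polar hp ha hz h1)
    refine exists_eq_sq_smul_of_smul_eq hp ha (w := m • r + y) ?_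
    rw [← Matrix.mulVec_smul, hw', Matrix.mulVec_add, Matrix.mulVec_smul, Matrix.mulVec_smul,
      hr, hy]
    module
  choose g hg using fun i => key (Pi.single i 1)
  refine ⟨(Matrix.of g)ᵀ, ?_⟩
  ext i j
  have := congrFun (hg j) i
  rw [Matrix.mulVec_mulVec, Matrix.mulVec_single_one] at this
  exact this

end Rows

/-! ### Generating matrices -/

theorem mul_eq_smul_one_comm {n : ℕ} {c : ℤ} (hc : c ≠ 0) {I M : Matrix (Fin n) (Fin n) ℤ}
    (h : I * M = c • (1 : Matrix (Fin n) (Fin n) ℤ)) :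
    M * I = c • (1 : Matrix (Fin n) (Fin n) ℤ) := by
  have hd : I.det ≠ 0 := by
    intro h0
    have := congrArg Matrix.det h
    rw [Matrix.det_mul, h0, zero_mul, Matrix.det_smul, Matrix.det_one, mul_one] at this
    exact pow_ne_zero _ hc this.symm
  have h1 := congrArg (fun X => I.adjugate * (X * I)) h
  simp only [Matrix.mul_assoc, Matrix.smul_mul, Matrix.mul_smul, Matrix.one_mul] at h1
  rw [← Matrix.mul_assoc, Matrix.adjugate_mul, Matrix.smul_mul, Matrix.one_mul, smul_comm] at h1
  exact smul_right_injective _ hd h1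

theorem eq_of_mul_eq_smul_one {n m : ℕ} {c : ℤ} (hc : c ≠ 0) {I M : Matrix (Fin n) (Fin n) ℤ}
    (h : M * I = c • (1 : Matrix (Fin n) (Fin n) ℤ)) {X Y : Matrix (Fin n) (Fin m) ℤ}
    (hXY : I * X = I * Y) : X = Y := by
  have h1 := congrArg (M * ·) hXY
  simp only [← Matrix.mul_assoc, h, Matrix.smul_mul, Matrix.one_mul] at h1
  exact smul_right_injective _ hc h1

section Generating

variable {q : QuadraticForm ℤ (Fin 3 → ℤ)} {b : Module.Basis (Fin 4) ℤ (CliffordAlgebra.even q)}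
  {J : Ideal (CliffordAlgebra.even q)} {I I' M M' : Matrix (Fin 4) (Fin 4) ℤ} {p : ℕ}

theorem IsGeneratingMatrix.exists_eq_mul (hI : IsGeneratingMatrix b J I)
    (hI' : IsGeneratingMatrix b J I') : ∃ U, I' = I * U := by
  have h (j : Fin 4) : ∃ z, I' *ᵥ Pi.single j 1 = I *ᵥ z := by
    obtain ⟨z, hz⟩ := (hI (b.equivFun.symm (I' *ᵥ Pi.single j 1))).1
      ((hI' _).2 ⟨Pi.single j 1, LinearEquiv.apply_symm_apply _ _⟩)
    exact ⟨z, by rw [← hz, LinearEquiv.apply_symm_apply]⟩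
  choose z hz using h
  refine ⟨(Matrix.of z)ᵀ, ?_⟩
  ext i j
  have := congrFun (hz j) i
  rw [Matrix.mulVec_single_one] at this
  exact this

theorem IsGeneratingMatrix.exists_unit (hp : p ≠ 0) (hI : IsGeneratingMatrix b J I)
    (hI' : IsGeneratingMatrix b J I') (h : I * M = (p : ℤ) • (1 : Matrix (Fin 4) (Fin 4) ℤ))
    (h' : I' * M' = (p : ℤ) • (1 : Matrix (Fin 4) (Fin 4) ℤ)) :
    ∃ U : GL (Fin 4) ℤ, M = (U : Matrix (Fin 4) (Fin 4) ℤ) * M' := by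
  have hp0 : (p : ℤ) ≠ 0 := by exact_mod_cast hp
  have hc := mul_eq_smul_one_comm hp0 h
  obtain ⟨U, hU⟩ := hI.exists_eq_mul hI'
  obtain ⟨U', hU'⟩ := hI'.exists_eq_mul hI
  have h1 : U * U' = 1 := eq_of_mul_eq_smul_one hp0 hc (by
    rw [← Matrix.mul_assoc, ← hU, ← hU', Matrix.mul_one])
  refine ⟨⟨U, U', h1, mul_eq_one_comm.1 h1⟩, eq_of_mul_eq_smul_one hp0 hc ?_⟩
  change I * M = I * (U * M')
  rw [← Matrix.mul_assoc, ← hU, h, h']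

theorem IsGeneratingMatrix.mul_unit (hI : IsGeneratingMatrix b J I) (U : GL (Fin 4) ℤ) :
    IsGeneratingMatrix b J (I * (U : Matrix (Fin 4) (Fin 4) ℤ)) := by
  intro x
  rw [hI x]
  constructor
  · rintro ⟨z, hz⟩
    refine ⟨(U⁻¹ : GL (Fin 4) ℤ).val *ᵥ z, ?_⟩
    rw [hz, Matrix.mulVec_mulVec, Matrix.mul_assoc, ← Units.val_mul, mul_inv_cancel,
      Units.val_one, Matrix.mul_one]
  · rintro ⟨z, hz⟩
    exact ⟨U.val *ᵥ z, by rw [hz, Matrix.mulVec_mulVec]⟩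

theorem IsGeneratingMatrix.ideal_eq {J' : Ideal (CliffordAlgebra.even q)}
    (hI : IsGeneratingMatrix b J I) (hI' : IsGeneratingMatrix b J' I) : J = J' :=
  Ideal.ext fun x => (hI x).trans (hI' x).symm

/-- Containing `p` times the whole algebra forces `J` to have full rank. The columns of `M` are the
coordinates of the elements `p b_j` in a basis of `J`. -/
theorem exists_isGeneratingMatrix (b : Module.Basis (Fin 4) ℤ (CliffordAlgebra.even q))
    (hp : p ≠ 0) (hJ : (p : ℤ) • (1 : CliffordAlgebra.even q) ∈ J) :
    ∃ I M, IsGeneratingMatrix b J I ∧ I * M = (p : ℤ) • (1 : Matrix (Fin 4) (Fin 4) ℤ) ∧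
      I.det.natAbs = (Submodule.toAddSubgroup J).index := by
  have hp0 : (p : ℤ) ≠ 0 := by exact_mod_cast hp
  have : Module.Free ℤ (CliffordAlgebra.even q) := Module.Free.of_basis b
  have : Module.Finite ℤ (CliffordAlgebra.even q) := Module.Finite.of_basis b
  have hmem (x : CliffordAlgebra.even q) : (p : ℤ) • x ∈ J := by
    have := J.mul_mem_left x hJ
    rwa [mul_smul_comm, mul_one] at this
  let N : Submodule ℤ (CliffordAlgebra.even q) := (Submodule.toAddSubgroup J).toIntSubmodule
  have hN (x) : x ∈ N ↔ x ∈ J := Iff.rfl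
  have hr : Module.finrank ℤ N = 4 := by
    have h4 : Module.finrank ℤ (CliffordAlgebra.even q) = 4 := by
      rw [Module.finrank_eq_card_basis b, Fintype.card_fin]
    refine le_antisymm (h4 ▸ N.finrank_le) ?_
    let f : CliffordAlgebra.even q →ₗ[ℤ] N :=
      ((p : ℤ) • LinearMap.id).codRestrict N fun x => hmem x
    rw [← h4]
    refine LinearMap.finrank_le_finrank_of_injective (f := f) fun x y hxy => ?_
    exact even_smul_cancel hp0 (congrArg Subtype.val hxy)
  let bN : Module.Basis (Fin 4) ℤ N := Module.finBasisOfFinrankEq ℤ N hr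
  have hI : IsGeneratingMatrix b J (b.toMatrix fun j => (bN j : CliffordAlgebra.even q)) := by
    have key (z : Fin 4 → ℤ) :
        (b.toMatrix fun j => (bN j : CliffordAlgebra.even q)) *ᵥ z =
          b.equivFun (bN.equivFun.symm z : N) := by
      ext i
      rw [Module.Basis.equivFun_symm_apply, AddSubmonoidClass.coe_finsetSum, map_sum,
        Finset.sum_apply, Matrix.mulVec, dotProduct]
      refine Finset.sum_congr rfl fun j _ => ?_
      rw [Module.Basis.toMatrix_apply, mul_comm]
      exact (congrFun (map_smul b.equivFun (z j) (bN j : CliffordAlgebra.even q)) i).symm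
    intro x
    constructor
    · intro hx
      exact ⟨bN.equivFun ⟨x, hx⟩, by rw [key, LinearEquiv.symm_apply_apply]⟩
    · rintro ⟨z, hz⟩
      rw [key] at hz
      rw [b.equivFun.injective hz]
      exact (bN.equivFun.symm z).2
  have h (j : Fin 4) := (hI _).1 (hmem (b j))
  choose z hz using h
  refine ⟨_, (Matrix.of z)ᵀ, hI, ?_, ?_⟩
  · ext i j
    have := congrFun (hz j) i
    rw [map_smul, Module.Basis.equivFun_apply, Module.Basis.repr_self] at this
    rw [Matrix.mul_apply]
    refine Eq.trans this.symm ?_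
    simp [Finsupp.single_apply, Matrix.one_apply, eq_comm]
  · rw [← Module.Basis.det_apply]
    exact Submodule.natAbs_det_basis_change b N bN

end Generating

/-! ### The extension ideal of an automorph -/

section Ideal

variable {q q' q'' : QuadraticForm ℤ (Fin 3 → ℤ)} {p : ℕ}

theorem exists_isDual_isLift (hp : p.Prime) (hq : formDet q ≠ 0) (hpq : ¬ (p : ℤ) ∣ formDet q)
    (hdet : formDet q' = formDet q) (A : reps q' ((p : ℤ) ^ 2 • q)) :
    ∃ (B : reps q ((p : ℤ) ^ 2 • q')) (ψ : _) (ψ' : _) (ε : ℤ), IsDual p A B ∧ IsLift p A ψ ∧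
      IsLift p B ψ' ∧ ε * ε = 1 ∧
      ∀ k i : Fin 3, (natBasis q).equivFun (ψ' (natBasis q' k.succ)) i.succ = ε * A.1 k i := by
  have hp0 : (p : ℤ) ≠ 0 := by exact_mod_cast hp.ne_zero
  obtain ⟨B, hB, ε, -, hAB, hBA, hadj, hg⟩ := exists_dual hp hq hpq hdet A.2
  -- Dualizing twice returns `A`, so the adjugate of `B` is `±p A`.
  obtain ⟨A', -, ε', hε', hBA', -, hadj', -⟩ := exists_dual hp (hdet ▸ hq) (hdet ▸ hpq) hdet.symm hB
  have hA' : A' = A.1 := eq_of_mul_eq_smul_one (pow_ne_zero 2 hp0) hAB (hBA'.trans hBA.symm)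
  rw [hA'] at hadj'
  obtain ⟨ψ, hψ⟩ := exists_isLift hp A fun i j => by
    rw [hadj]; exact ⟨ε * B i j, by simp only [Matrix.smul_apply, smul_eq_mul]; ring⟩
  obtain ⟨ψ', hψ'⟩ := exists_isLift hp ⟨B, hB⟩ fun i j => by
    rw [hadj']; exact ⟨ε' * A.1 i j, by simp only [Matrix.smul_apply, smul_eq_mul]; ring⟩
  exact ⟨⟨B, hB⟩, ψ, ψ', ε', ⟨hAB, hBA, hg⟩, hψ, hψ', hε',
    hψ'.equivFun_map_succ hp.ne_zero hadj'⟩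

theorem IsDual.unique (hp : p ≠ 0) {A : reps q' ((p : ℤ) ^ 2 • q)}
    {B B' : reps q ((p : ℤ) ^ 2 • q')} (h : IsDual p A B)
    (h' : A.1 * B'.1 = (p : ℤ) ^ 2 • (1 : Matrix (Fin 3) (Fin 3) ℤ)) : B' = B := by
  have hp0 : (p : ℤ) ≠ 0 := by exact_mod_cast hp
  exact Subtype.ext
    (eq_of_mul_eq_smul_one (pow_ne_zero 2 hp0) h.mul_eq' (h'.trans h.mul_eq.symm))

variable {B : reps q ((p : ℤ) ^ 2 • q')}
  {ψ' : CliffordAlgebra.even q' →ₗ[ℤ] CliffordAlgebra.even q}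

theorem IsLift.extIdeal_eq (h : IsLift p B ψ') : extIdeal p B = Ideal.span (Set.range ψ') :=
  congrArg Ideal.span (Set.ext h.mem_liftImage_iff)

theorem IsLift.map_mem_extIdeal (h : IsLift p B ψ') (y : CliffordAlgebra.even q') :
    ψ' y ∈ extIdeal p B :=
  h.extIdeal_eq ▸ Ideal.subset_span ⟨y, rfl⟩

theorem IsLift.smul_mem_extIdeal (h : IsLift p B ψ') (w : CliffordAlgebra.even q) :
    (p : ℤ) • w ∈ extIdeal p B := by
  have := (extIdeal p B).mul_mem_left w (h.map_mem_extIdeal 1)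
  rwa [h.map_one, mul_smul_comm, mul_one] at this

/-- The generators annihilate `ψ' y` modulo `p` by the product rule. Conversely an annihilator lies
in `C ν + p C`, and both `ν = ψ' y` and `p = ψ' 1` belong to the ideal. -/
theorem IsLift.mem_extIdeal_iff (h : IsLift p B ψ') (hp : p.Prime)
    (hpq : ¬ (p : ℤ) ∣ formDet q) {y : CliffordAlgebra.even q'} (hν : IsNilpotentMod p (ψ' y))
    (x : CliffordAlgebra.even q) :
    x ∈ extIdeal p B ↔ ∃ w, x * ψ' y = (p : ℤ) • w := by
  constructor
  · intro hx
    rw [h.extIdeal_eq] at hx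
    induction hx using Submodule.span_induction with
    | mem x hx =>
      obtain ⟨z, rfl⟩ := hx
      exact ⟨_, h.map_mul_map hp.ne_zero z y⟩
    | zero => exact ⟨0, by simp⟩
    | add x z _ _ hx hz =>
      obtain ⟨w, hw⟩ := hx
      obtain ⟨w', hw'⟩ := hz
      exact ⟨w + w', by rw [add_mul, hw, hw', smul_add]⟩
    | smul a x _ hx =>
      obtain ⟨w, hw⟩ := hx
      exact ⟨a * w, by rw [smul_eq_mul, mul_assoc, hw, mul_smul_comm]⟩
  · intro hx
    obtain ⟨c, w, rfl⟩ := hν.exists_eq_mul_add hp hpq hx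
    exact add_mem ((extIdeal p B).mul_mem_left c (h.map_mem_extIdeal y)) (h.smul_mem_extIdeal w)

/-- The square vanishes modulo `p` by the product rule; primitivity of `A` provides a basis element
with nonzero image. -/
theorem IsLift.exists_isNilpotentMod (h : IsLift p B ψ') (hp : p.Prime)
    {A : Matrix (Fin 3) (Fin 3) ℤ} {ε : ℤ} (hε : ε * ε = 1)
    (hA : ∀ k i : Fin 3, (natBasis q).equivFun (ψ' (natBasis q' k.succ)) i.succ = ε * A k i)
    (hprim : ∃ k i, ¬ (p : ℤ) ∣ A k i) : ∃ y, IsNilpotentMod p (ψ' y) := by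
  obtain ⟨k, i, hki⟩ := hprim
  refine ⟨natBasis q' k.succ, ?_, _, h.map_mul_map hp.ne_zero _ _⟩
  rintro ⟨w, hw⟩
  have h1 := hA k i
  rw [hw, map_smul, Pi.smul_apply, smul_eq_mul] at h1
  exact hki ⟨ε * (natBasis q).equivFun w i.succ, by linear_combination -ε * h1 - A k i * hε⟩

theorem rowsMod_of_forall_eq {A : Matrix (Fin 3) (Fin 3) ℤ} {ε : ℤ} (hε : ε * ε = 1)
    (hA : ∀ k i : Fin 3, (natBasis q).equivFun (ψ' (natBasis q' k.succ)) i.succ = ε * A k i)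
    {ν : CliffordAlgebra.even q} (hν : ∀ y, ∃ (t : ℤ) (w : _), ψ' y = t • ν + (p : ℤ) • w) :
    RowsMod p (fun i => (natBasis q).equivFun ν i.succ) A := by
  choose t w htw using hν
  refine ⟨fun k => ε * t (natBasis q' k.succ),
    Matrix.of fun k i => ε * (natBasis q).equivFun (w (natBasis q' k.succ)) i.succ, ?_⟩
  ext k i
  have h1 := hA k i
  rw [htw, map_add, map_smul, map_smul, Pi.add_apply, Pi.smul_apply, Pi.smul_apply, smul_eq_mul,
    smul_eq_mul] at h1
  rw [Matrix.add_apply, Matrix.vecMulVec_apply, Matrix.smul_apply, Matrix.of_apply, smul_eq_mul]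
  linear_combination -ε * h1 - A k i * hε

theorem IsLift.exists_eq_smul_add (h : IsLift p B ψ') (hp : p.Prime)
    (hpq : ¬ (p : ℤ) ∣ formDet q) {y : CliffordAlgebra.even q'} (hν : IsNilpotentMod p (ψ' y))
    (z : CliffordAlgebra.even q') :
    ∃ (t : ℤ) (w : _), ψ' z = t • ψ' y + (p : ℤ) • w :=
  hν.exists_eq_smul_add hp hpq ⟨_, h.map_mul_map hp.ne_zero _ _⟩
    ⟨_, h.map_mul_map hp.ne_zero _ _⟩

/-- Automorphs whose duals have the same extension ideal have integral quotient. -/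
theorem exists_mul_eq_of_extIdeal_eq (hp : p.Prime) (hq : formDet q ≠ 0)
    (hpq : ¬ (p : ℤ) ∣ formDet q) (hdet : formDet q' = formDet q) (hdet' : formDet q'' = formDet q)
    {A : reps q' ((p : ℤ) ^ 2 • q)} {B : reps q ((p : ℤ) ^ 2 • q')}
    {A' : reps q'' ((p : ℤ) ^ 2 • q)} {B' : reps q ((p : ℤ) ^ 2 • q'')}
    (hAB : A.1 * B.1 = (p : ℤ) ^ 2 • (1 : Matrix (Fin 3) (Fin 3) ℤ))
    (hAB' : A'.1 * B'.1 = (p : ℤ) ^ 2 • (1 : Matrix (Fin 3) (Fin 3) ℤ))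
    (hA : ∃ k i, ¬ (p : ℤ) ∣ A.1 k i) (hA' : ∃ k i, ¬ (p : ℤ) ∣ A'.1 k i)
    (hJ : extIdeal p B = extIdeal p B') :
    ∃ V : Matrix (Fin 3) (Fin 3) ℤ, A'.1 = V * A.1 := by
  have hp0 : (p : ℤ) ≠ 0 := by exact_mod_cast hp.ne_zero
  obtain ⟨B₀, -, ψ, ε, hd, -, hψ, hε, hc⟩ := exists_isDual_isLift hp hq hpq hdet A
  obtain rfl := hd.unique hp.ne_zero hAB
  obtain ⟨B₁, -, ψ₁, ε₁, hd₁, -, hψ₁, hε₁, hc₁⟩ := exists_isDual_isLift hp hq hpq hdet' A'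
  obtain rfl := hd₁.unique hp.ne_zero hAB'
  obtain ⟨y, hy⟩ := hψ.exists_isNilpotentMod hp hε hc hA
  obtain ⟨y₁, hy₁⟩ := hψ₁.exists_isNilpotentMod hp hε₁ hc₁ hA'
  have hu := rowsMod_of_forall_eq hε hc (hψ.exists_eq_smul_add hp hpq hy)
  have hu₁ : RowsMod p (fun i => (natBasis q).equivFun (ψ y) i.succ) A'.1 := by
    refine rowsMod_of_forall_eq hε₁ hc₁ fun z => ?_
    obtain ⟨t, w, h1⟩ := hψ₁.exists_eq_smul_add hp hpq hy₁ z
    -- Each of the two nilpotents lies in the common ideal, so they annihilate one another on both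
    -- sides and are proportional modulo `p`.
    obtain ⟨s, w', h2⟩ := hy.exists_eq_smul_add hp hpq (x := ψ₁ y₁)
      ((hψ.mem_extIdeal_iff hp hpq hy _).1 (hJ ▸ hψ₁.map_mem_extIdeal y₁))
      ((hψ₁.mem_extIdeal_iff hp hpq hy₁ _).1 (hJ ▸ hψ.map_mem_extIdeal y))
    exact ⟨t * s, t • w' + w, by rw [h1, h2]; module⟩
  obtain ⟨V, hV⟩ := hd.exists_mul_eq hp hd₁ hpq (hdet ▸ hpq) (hdet' ▸ hpq) hA hA' hu hu₁
  refine ⟨V, smul_right_injective _ (pow_ne_zero 2 hp0) ?_⟩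
  simp only
  rw [← Matrix.smul_mul, ← hV, Matrix.mul_assoc, hd.mul_eq', Matrix.mul_smul, Matrix.mul_one]

/-- The extension ideal only depends on the lattice spanned by the columns. -/
theorem extIdeal_le_of_eq_mul (hp : p ≠ 0) (h : IsLift p B ψ')
    {B' : reps q ((p : ℤ) ^ 2 • q'')}
    {ψ'' : CliffordAlgebra.even q'' →ₗ[ℤ] CliffordAlgebra.even q} (h' : IsLift p B' ψ'')
    {V : Matrix (Fin 3) (Fin 3) ℤ} (hV : B'.1 = B.1 * V) : extIdeal p B' ≤ extIdeal p B := by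
  have hp0 : (p : ℤ) ≠ 0 := by exact_mod_cast hp
  rw [h'.extIdeal_eq, h.extIdeal_eq]
  refine Ideal.span_mono ?_
  have h1 : LinearMap.range ψ'' ≤ LinearMap.range ψ' := by
    rintro _ ⟨x, rfl⟩
    rw [← (natBasis q'').sum_repr x, map_sum]
    refine sum_mem fun k _ => ?_
    rw [map_smul]
    refine Submodule.smul_mem _ _ ?_
    refine Fin.cases ?_ (fun k => ?_) k
    · exact ⟨1, by rw [h.map_one, natBasis_zero, h'.map_one]⟩
    · obtain ⟨a, u, v, -, -, hk⟩ := natBasis_succ k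
      rw [hk, map_smul]
      refine Submodule.smul_mem _ _ ⟨evenMul q' (V *ᵥ u) (V *ᵥ v), even_smul_cancel hp0 ?_⟩
      rw [h.smul_map_evenMul hp, h'.smul_map_evenMul hp, hV, Matrix.mulVec_mulVec,
        Matrix.mulVec_mulVec]
  rintro _ ⟨x, rfl⟩
  exact h1 ⟨x, rfl⟩

end Ideal

/-! ### The map on classes -/

section Classes

theorem equivalent_of_apply_mulVec {n : ℕ} {n₁ n₂ : QuadraticForm ℤ (Fin n → ℤ)}
    (U : GL (Fin n) ℤ) (h : ∀ y, n₁ ((U : Matrix (Fin n) (Fin n) ℤ) *ᵥ y) = n₂ y) :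
    QuadraticMap.Equivalent n₂ n₁ :=
  ⟨{ Matrix.toLin'OfInv (Units.inv_mul U) (Units.mul_inv U) with
      map_app' := fun y => (congrArg n₁ (Matrix.toLin'_apply _ _)).trans (h y) }⟩

theorem exists_unit_mulVec_eq {n : ℕ} {n₁ n₂ : QuadraticForm ℤ (Fin n → ℤ)}
    (h : QuadraticMap.Equivalent n₁ n₂) :
    ∃ U : GL (Fin n) ℤ, ∀ y, n₁ ((U : Matrix (Fin n) (Fin n) ℤ) *ᵥ y) = n₂ y := by
  obtain ⟨f⟩ := h
  let e := f.toLinearEquiv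
  have h1 : LinearMap.toMatrix' e.symm.toLinearMap * LinearMap.toMatrix' e.toLinearMap = 1 := by
    rw [← LinearMap.toMatrix'_comp, LinearEquiv.symm_comp, LinearMap.toMatrix'_id]
  refine ⟨⟨_, _, h1, mul_eq_one_comm.1 h1⟩, fun y => ?_⟩
  change n₁ (LinearMap.toMatrix' e.symm.toLinearMap *ᵥ y) = _
  rw [LinearMap.toMatrix'_mulVec, ← f.map_app]
  exact congrArg n₂ (e.apply_symm_apply y)

theorem IsCompleteSystem.eq_of_apply_mulVec {m k : ℕ} {n : QuadraticForm ℤ (Fin m → ℤ)}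
    {ns : Fin k → QuadraticForm ℤ (Fin m → ℤ)} (hns : IsCompleteSystem n ns) {j j' : Fin k}
    (U : GL (Fin m) ℤ)
    (h : ∀ y, ns j ((U : Matrix (Fin m) (Fin m) ℤ) *ᵥ y) = ns j' y) : j = j' :=
  (hns.2 (ns j) (hns.1 j)).unique (QuadraticMap.Equivalent.refl _)
    (equivalent_of_apply_mulVec U h)

/-- Evaluating `Q` at `I y` gives `c²` times either side. Hence a unit linking two representations
of the same form is automatically an isometry. -/
theorem apply_mulVec_eq_of_mem_reps {m : ℕ} {c : ℤ} (hc : c ≠ 0)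
    {n₁ n₂ Q : QuadraticForm ℤ (Fin m → ℤ)} {M M' I U : Matrix (Fin m) (Fin m) ℤ}
    (hM : M ∈ reps n₁ Q) (hM' : M' ∈ reps n₂ Q) (hU : M = U * M')
    (hI : M' * I = c • (1 : Matrix (Fin m) (Fin m) ℤ)) (y : Fin m → ℤ) :
    n₁ (U *ᵥ y) = n₂ y := by
  have h1 : c * c * n₁ (U *ᵥ y) = Q (I *ᵥ y) := by
    rw [← hM, hU, Matrix.mulVec_mulVec, Matrix.mul_assoc, hI, Matrix.mul_smul, Matrix.mul_one,
      Matrix.smul_mulVec, QuadraticMap.map_smul, smul_eq_mul]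
  have h2 : c * c * n₂ y = Q (I *ᵥ y) := by
    rw [← hM', Matrix.mulVec_mulVec, hI, Matrix.smul_mulVec, Matrix.one_mulVec,
      QuadraticMap.map_smul, smul_eq_mul]
  exact mul_left_cancel₀ (mul_ne_zero hc hc) (h1.trans h2.symm)

theorem leftClass_eq_iff {m n : ℕ} {q : QuadraticForm ℤ (Fin m → ℤ)}
    {T : Set (Matrix (Fin m) (Fin n) ℤ)} {A D : T} :
    leftClass q A = leftClass q D ↔
      ∃ U ∈ formUnits q, A.1 = (U : Matrix (Fin m) (Fin m) ℤ) * D.1 :=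
  Quotient.eq (r := leftClassSetoid q T)

variable {q q' q'' : QuadraticForm ℤ (Fin 3 → ℤ)} {p : ℕ}
  {b : Module.Basis (Fin 4) ℤ (CliffordAlgebra.even q)}

theorem exists_not_dvd_of_mem_primReps {Q : QuadraticForm ℤ (Fin 3 → ℤ)} (hp : p.Prime)
    {A : Matrix (Fin 3) (Fin 3) ℤ} (hA : A ∈ primReps q' Q) : ∃ k i, ¬ (p : ℤ) ∣ A k i := by
  by_contra! h
  exact (Nat.prime_iff_prime_int.1 hp).not_isUnit (hA.2 p h)

theorem exists_isUpsilon (hp : p.Prime) (hq : formDet q ≠ 0) (hpq : ¬ (p : ℤ) ∣ formDet q)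
    (hdet : formDet q' = formDet q) (b : Module.Basis (Fin 4) ℤ (CliffordAlgebra.even q))
    (A : reps q' ((p : ℤ) ^ 2 • q)) (hA : ∃ k i, ¬ (p : ℤ) ∣ A.1 k i) :
    ∃ (M : Matrix (Fin 4) (Fin 4) ℤ) (n' : QuadraticForm ℤ (Fin 4 → ℤ)), IsUpsilon p b A M ∧
      M ∈ reps n' ((p : ℤ) • normForm q b) ∧ IsSimilar (normForm q b) n' := by
  have hp0 : (p : ℤ) ≠ 0 := by exact_mod_cast hp.ne_zero
  obtain ⟨B, ψ, ψ', ε, hd, hψ, hψ', hε, hc⟩ := exists_isDual_isLift hp hq hpq hdet A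
  obtain ⟨y, hy⟩ := hψ'.exists_isNilpotentMod hp hε hc hA
  have hJ := hψ'.mem_extIdeal_iff hp hpq hy
  obtain ⟨I, M, hI, hIM, hdetI⟩ := exists_isGeneratingMatrix b hp.ne_zero (hψ'.smul_mem_extIdeal 1)
  have hidx := hy.index_sq_eq hp hpq (J := Submodule.toAddSubgroup (extIdeal p B)) hJ
  have hI2 : I.det ^ 2 = (p : ℤ) ^ 4 := by
    rw [← Int.natAbs_sq, hdetI]
    exact_mod_cast hidx.trans (by ring)
  -- Elements of the ideal annihilate `ν` on the left modulo `p`, hence are singular there.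
  have hdvd (z : Fin 4 → ℤ) : (p : ℤ) ∣ (normForm q b).comp (Matrix.mulVecLin I) z := by
    change (p : ℤ) ∣ normForm q b (I *ᵥ z)
    rw [normForm_apply]
    refine dvd_evenNorm_of_mul hp hy.ne_zero ((hJ _).1 ((hI _).2 ⟨z, ?_⟩))
    exact LinearEquiv.apply_symm_apply _ _
  obtain ⟨n', hn'⟩ := exists_eq_smul_of_dvd _ hp0 hdvd
  have hn (z : Fin 4 → ℤ) : normForm q b (I *ᵥ z) = p * n' z := congrArg (fun Q => Q z) hn'
  have hIr : I ∈ reps (normForm q b) ((p : ℤ) • n') := hn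
  refine ⟨M, n', ⟨B, hd.mul_eq, psi_mul_psi hp.ne_zero hψ hψ' hd.mul_eq, I, hI, hIM⟩, ?_, ?_,
    p, hp0, ?_, I, hIr⟩
  · intro z
    have h1 := hn (M *ᵥ z)
    rw [Matrix.mulVec_mulVec, hIM, Matrix.smul_mulVec, Matrix.one_mulVec,
      QuadraticMap.map_smul, smul_eq_mul] at h1
    rw [_root_.smul_apply, smul_eq_mul]
    exact mul_left_cancel₀ hp0 (by rw [← h1]; ring)
  -- Index `p²` makes the squared determinant exactly the `p⁴` lost when a quaternary form is
  -- divided by `p`.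
  · have h1 := det_sq_mul_formDet hIr
    rw [formDet_smul, hI2] at h1
    exact (mul_left_cancel₀ (pow_ne_zero 4 hp0) h1).symm
  · refine (Nat.prime_iff_prime_int.1 hp).coprime_iff_not_dvd.2 fun h => hpq ?_
    have h4 := four_mul_formDet_normForm q b
    exact (Nat.prime_iff_prime_int.1 hp).dvd_of_dvd_pow (h4 ▸ Dvd.dvd.mul_left h 4)

theorem IsUpsilon.mul_left {A : reps q' ((p : ℤ) ^ 2 • q)} {M M' : Matrix (Fin 4) (Fin 4) ℤ}
    (h : IsUpsilon p b A M) (U : GL (Fin 4) ℤ) (hU : M = (U : Matrix (Fin 4) (Fin 4) ℤ) * M') :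
    IsUpsilon p b A M' := by
  obtain ⟨B, h1, h2, I, hI, hIM⟩ := h
  exact ⟨B, h1, h2, _, hI.mul_unit U, by rw [Matrix.mul_assoc, ← hU, hIM]⟩

/-- Changing `A` by a unit on the left changes `B` by a unit on the right, which alters neither the
lattice `B ℤ³` nor the ideal. -/
theorem IsUpsilon.of_eq_mul (hp : p.Prime) (hq : formDet q ≠ 0) (hpq : ¬ (p : ℤ) ∣ formDet q)
    (hdet : formDet q' = formDet q)
    {A A' : reps q' ((p : ℤ) ^ 2 • q)} {M : Matrix (Fin 4) (Fin 4) ℤ}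
    (h : IsUpsilon p b A M) (U : GL (Fin 3) ℤ)
    (hU : A.1 = (U : Matrix (Fin 3) (Fin 3) ℤ) * A'.1) : IsUpsilon p b A' M := by
  have hp0 : (p : ℤ) ≠ 0 := by exact_mod_cast hp.ne_zero
  obtain ⟨B, h1, -, I, hI, hIM⟩ := h
  obtain ⟨B₀, -, ψ', -, hd, -, hψ', -⟩ := exists_isDual_isLift hp hq hpq hdet A
  obtain rfl := hd.unique hp.ne_zero h1
  obtain ⟨B', ψ, ψ'', -, hd', hψ, hψ'', -⟩ := exists_isDual_isLift hp hq hpq hdet A'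
  have hB : B'.1 = B.1 * U := by
    refine eq_of_mul_eq_smul_one (pow_ne_zero 2 hp0) hd'.mul_eq' (hd'.mul_eq.trans ?_)
    have h2 : A'.1 = (U⁻¹ : GL (Fin 3) ℤ).val * A.1 := by
      rw [hU, ← Matrix.mul_assoc, ← Units.val_mul, inv_mul_cancel, Units.val_one, Matrix.one_mul]
    rw [h2, Matrix.mul_assoc, ← Matrix.mul_assoc A.1, h1, Matrix.smul_mul, Matrix.one_mul,
      Matrix.mul_smul, ← Units.val_mul, inv_mul_cancel, Units.val_one]
  have hB' : B.1 = B'.1 * (U⁻¹ : GL (Fin 3) ℤ).val := by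
    rw [hB, Matrix.mul_assoc, ← Units.val_mul, mul_inv_cancel, Units.val_one, Matrix.mul_one]
  have hJ : extIdeal p B = extIdeal p B' :=
    le_antisymm (extIdeal_le_of_eq_mul hp.ne_zero hψ'' hψ' hB')
      (extIdeal_le_of_eq_mul hp.ne_zero hψ' hψ'' hB)
  exact ⟨B', hd'.mul_eq, psi_mul_psi hp.ne_zero hψ hψ'' hd'.mul_eq, I, hJ ▸ hI, hIM⟩

theorem IsUpsilon.exists_unit (hp : p.Prime) (hq : formDet q ≠ 0)
    (hpq : ¬ (p : ℤ) ∣ formDet q) (hdet : formDet q' = formDet q)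
    {A : reps q' ((p : ℤ) ^ 2 • q)} {n₁ n₂ Q : QuadraticForm ℤ (Fin 4 → ℤ)}
    {M M' : Matrix (Fin 4) (Fin 4) ℤ}
    (h : IsUpsilon p b A M) (h' : IsUpsilon p b A M') (hM : M ∈ reps n₁ Q)
    (hM' : M' ∈ reps n₂ Q) :
    ∃ U : GL (Fin 4) ℤ, M = (U : Matrix (Fin 4) (Fin 4) ℤ) * M' ∧
      ∀ y, n₁ ((U : Matrix (Fin 4) (Fin 4) ℤ) *ᵥ y) = n₂ y := by
  have hp0 : (p : ℤ) ≠ 0 := by exact_mod_cast hp.ne_zero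
  obtain ⟨B, h1, -, I, hI, hIM⟩ := h
  obtain ⟨B', h1', -, I', hI', hIM'⟩ := h'
  obtain ⟨B₀, -, -, -, hd, -⟩ := exists_isDual_isLift hp hq hpq hdet A
  obtain rfl := hd.unique hp.ne_zero h1
  obtain rfl := hd.unique hp.ne_zero h1'
  obtain ⟨U, hU⟩ := hI.exists_unit hp.ne_zero hI' hIM hIM'
  exact ⟨U, hU, apply_mulVec_eq_of_mem_reps hp0 hM hM' hU (mul_eq_smul_one_comm hp0 hIM')⟩

/-- The matrix `M` determines its generating matrix, hence the ideal. Equality of ideals gives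
integral quotients in both directions, which are mutually inverse. -/
theorem IsUpsilon.exists_unit_automorph (hp : p.Prime) (hq : formDet q ≠ 0)
    (hpq : ¬ (p : ℤ) ∣ formDet q) (hdet : formDet q' = formDet q)
    (hdet' : formDet q'' = formDet q) {A : reps q' ((p : ℤ) ^ 2 • q)}
    {A' : reps q'' ((p : ℤ) ^ 2 • q)} (hA : ∃ k i, ¬ (p : ℤ) ∣ A.1 k i)
    (hA' : ∃ k i, ¬ (p : ℤ) ∣ A'.1 k i) {M : Matrix (Fin 4) (Fin 4) ℤ}
    (h : IsUpsilon p b A M) (h' : IsUpsilon p b A' M) :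
    ∃ U : GL (Fin 3) ℤ, A.1 = (U : Matrix (Fin 3) (Fin 3) ℤ) * A'.1 ∧
      ∀ y, q' ((U : Matrix (Fin 3) (Fin 3) ℤ) *ᵥ y) = q'' y := by
  have hp0 : (p : ℤ) ≠ 0 := by exact_mod_cast hp.ne_zero
  obtain ⟨B, h1, -, I, hI, hIM⟩ := h
  obtain ⟨B', h1', -, I', hI', hIM'⟩ := h'
  have hII : I = I' := by
    have h2 := mul_eq_smul_one_comm hp0 hIM
    have h2' := mul_eq_smul_one_comm hp0 hIM'
    exact eq_of_mul_eq_smul_one hp0 hIM (h2.trans h2'.symm)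
  subst hII
  have hJ := hI.ideal_eq hI'
  obtain ⟨V, hV⟩ := exists_mul_eq_of_extIdeal_eq hp hq hpq hdet hdet' h1 h1' hA hA' hJ
  obtain ⟨V', hV'⟩ := exists_mul_eq_of_extIdeal_eq hp hq hpq hdet' hdet h1' h1 hA' hA hJ.symm
  have hVV : V' * V = 1 := by
    have h2 := congrArg (· * B.1) hV'
    simp only [hV, Matrix.mul_assoc, h1, Matrix.mul_smul, Matrix.mul_one] at h2
    exact (smul_right_injective _ (pow_ne_zero 2 hp0) h2).symm
  exact ⟨⟨V', V, hVV, mul_eq_one_comm.1 hVV⟩, hV',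
    apply_mulVec_eq_of_mem_reps (pow_ne_zero 2 hp0) A.2 A'.2 hV' h1'⟩

theorem IsUpsilon.dividesPsi (hp : p.Prime) (hq : formDet q ≠ 0)
    (hpq : ¬ (p : ℤ) ∣ formDet q) (hdet : formDet q' = formDet q)
    {A : reps q' ((p : ℤ) ^ 2 • q)} {M : Matrix (Fin 4) (Fin 4) ℤ}
    (h : IsUpsilon p b A M) : DividesPsi p b M A := by
  have hp0 : (p : ℤ) ≠ 0 := by exact_mod_cast hp.ne_zero
  obtain ⟨B, h1, -, I, hI, hIM⟩ := h
  obtain ⟨B₀, ψ, ψ', -, hd, hψ, hψ', -⟩ := exists_isDual_isLift hp hq hpq hdet A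
  obtain rfl := hd.unique hp.ne_zero h1
  have hψψ (y) : ψ (ψ' y) = (p : ℤ) ^ 2 • y :=
    LinearMap.congr_fun (hψ.comp hp.ne_zero hψ' h1) y
  -- The left factor `r` is kept arbitrary so that the induction passes through left multiplication.
  have hdiv (x) (hx : x ∈ extIdeal p B) : ∀ r, ∃ w, ψ (r * x) = (p : ℤ) • w := by
    rw [hψ'.extIdeal_eq] at hx
    induction hx using Submodule.span_induction with
    | mem x hx =>
      obtain ⟨z, rfl⟩ := hx
      intro r
      refine ⟨ψ r * z, even_smul_cancel hp0 ?_⟩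
      rw [← hψ.map_mul_map hp.ne_zero, hψψ, mul_smul_comm, smul_smul, sq]
    | zero => exact fun r => ⟨0, by simp⟩
    | add x z _ _ hx hz =>
      intro r
      obtain ⟨w, hw⟩ := hx r
      obtain ⟨w', hw'⟩ := hz r
      exact ⟨w + w', by rw [mul_add, map_add, hw, hw', smul_add]⟩
    | smul a x _ hx =>
      intro r
      obtain ⟨w, hw⟩ := hx (r * a)
      exact ⟨w, by rw [smul_eq_mul, ← mul_assoc, hw]⟩
  set T := LinearMap.toMatrix (natBasis q) (natBasis q') ψ * (natBasis q).toMatrix b with hT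
  have hTz (z : Fin 4 → ℤ) : T *ᵥ z = (natBasis q').equivFun (ψ (b.equivFun.symm z)) := by
    rw [hT, ← Matrix.mulVec_mulVec, toMatrix_mulVec_eq]
    exact LinearMap.toMatrix_mulVec_repr _ _ _ _
  have hcol (j : Fin 4) : ∃ x, (T * I) *ᵥ Pi.single j 1 = (p : ℤ) • x := by
    obtain ⟨w, hw⟩ := hdiv (b.equivFun.symm (I *ᵥ Pi.single j 1))
      ((hI _).2 ⟨_, LinearEquiv.apply_symm_apply _ _⟩) 1
    rw [one_mul] at hw
    exact ⟨(natBasis q').equivFun w, by rw [← Matrix.mulVec_mulVec, hTz, hw, map_smul]⟩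
  choose X hX using hcol
  have hTI : T * I = (p : ℤ) • (Matrix.of X)ᵀ := by
    ext i j
    have := congrFun (hX j) i
    rw [Matrix.mulVec_single_one] at this
    exact this
  clear_value T
  have hTM : T = (Matrix.of X)ᵀ * M := by
    refine smul_right_injective _ hp0 ?_
    simp only
    rw [← Matrix.smul_mul, ← hTI, Matrix.mul_assoc, hIM, Matrix.mul_smul, Matrix.mul_one]
  refine ⟨(Matrix.of X)ᵀ, ?_⟩
  rw [← hTM, hT, hψ.toMatrix_eq]
  exact (Matrix.map_mul (f := Int.castRingHom ℚ)).symm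

end Classes

end AutomorphLift

/-! ### Assembly of the map on classes -/

theorem theorem6p7
    (q : QuadraticForm ℤ (Fin 3 → ℤ)) (hq : formDet q ≠ 0)
    (p : ℕ) (hp : p.Prime) (hpq : ¬ (p : ℤ) ∣ formDet q)
    (b : Module.Basis (Fin 4) ℤ (CliffordAlgebra.even q))
    {h H : ℕ}
    (qs : Fin h → QuadraticForm ℤ (Fin 3 → ℤ)) (hqs : IsCompleteSystem q qs)
    (ns : Fin H → QuadraticForm ℤ (Fin 4 → ℤ)) (hns : IsCompleteSystem (normForm q b) ns) :
    ∃ Υ : (Σ i : Fin h, LeftClasses (qs i) (primReps (qs i) ((p : ℤ) ^ 2 • q))) →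
        (Σ j : Fin H, LeftClasses (ns j) (reps (ns j) ((p : ℤ) • normForm q b))),
      (∀ (i : Fin h) (A : primReps (qs i) ((p : ℤ) ^ 2 • q))
          (j : Fin H) (M : reps (ns j) ((p : ℤ) • normForm q b)),
        Υ ⟨i, leftClass (qs i) A⟩ = ⟨j, leftClass (ns j) M⟩ ↔
          IsUpsilon p b ⟨A.1, A.2.1⟩ M.1) ∧
      Function.Injective Υ ∧
      (∀ (i : Fin h) (A : primReps (qs i) ((p : ℤ) ^ 2 • q))
          (j : Fin H) (M : reps (ns j) ((p : ℤ) • normForm q b)),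
        Υ ⟨i, leftClass (qs i) A⟩ = ⟨j, leftClass (ns j) M⟩ →
          DividesPsi p b M.1 ⟨A.1, A.2.1⟩) := by
  have hdet (i : Fin h) : formDet (qs i) = formDet q := (hqs.1 i).1
  have hprim (i : Fin h) (A : primReps (qs i) ((p : ℤ) ^ 2 • q)) :=
    exists_not_dvd_of_mem_primReps hp A.2
  have hex (i : Fin h) (A : primReps (qs i) ((p : ℤ) ^ 2 • q)) :
      ∃ (j : Fin H) (M : reps (ns j) ((p : ℤ) • normForm q b)),
        IsUpsilon p b ⟨A.1, A.2.1⟩ M.1 := by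
    obtain ⟨M, n', hM, hMn, hn'⟩ := exists_isUpsilon hp hq hpq (hdet i) b ⟨A.1, A.2.1⟩ (hprim i A)
    obtain ⟨j, f, -⟩ := hns.2 n' hn'
    obtain ⟨U, hU⟩ := exists_unit_mulVec_eq f
    refine ⟨j, ⟨U * M, fun X => ?_⟩, hM.mul_left U⁻¹ ?_⟩
    · rw [← Matrix.mulVec_mulVec, hU, hMn]
    · rw [← Matrix.mul_assoc, ← Units.val_mul, inv_mul_cancel, Units.val_one, Matrix.one_mul]
  have hfun (x : Σ i : Fin h, LeftClasses (qs i) (primReps (qs i) ((p : ℤ) ^ 2 • q))) :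
      ∃ (y : Σ j : Fin H, LeftClasses (ns j) (reps (ns j) ((p : ℤ) • normForm q b)))
        (A : primReps (qs x.1) ((p : ℤ) ^ 2 • q))
        (M : reps (ns y.1) ((p : ℤ) • normForm q b)), x.2 = leftClass (qs x.1) A ∧
        y.2 = leftClass (ns y.1) M ∧ IsUpsilon p b ⟨A.1, A.2.1⟩ M.1 := by
    obtain ⟨i, c⟩ := x
    obtain ⟨A, rfl⟩ := Quotient.exists_rep c
    obtain ⟨j, M, hM⟩ := hex i A
    exact ⟨⟨j, leftClass (ns j) M⟩, A, M, rfl, rfl, hM⟩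
  choose Υ hΥ using hfun
  -- The chosen value is known only through some representatives `A₀` and `M₀`; independence of both
  -- choices gives the full characterization.
  have hiff (i : Fin h) (A : primReps (qs i) ((p : ℤ) ^ 2 • q))
      (j : Fin H) (M : reps (ns j) ((p : ℤ) • normForm q b)) :
      Υ ⟨i, leftClass (qs i) A⟩ = ⟨j, leftClass (ns j) M⟩ ↔
        IsUpsilon p b ⟨A.1, A.2.1⟩ M.1 := by
    obtain ⟨A₀, M₀, hA₀, hM₀, hAM⟩ := hΥ ⟨i, leftClass (qs i) A⟩
    generalize Υ ⟨i, leftClass (qs i) A⟩ = y at M₀ hM₀ hAM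
    obtain ⟨j₀, y⟩ := y
    simp only at A₀ M₀ hA₀ hM₀ hAM
    subst hM₀
    obtain ⟨U, -, hU⟩ := leftClass_eq_iff.1 hA₀
    have hAM' : IsUpsilon p b ⟨A.1, A.2.1⟩ M₀.1 := by
      refine hAM.of_eq_mul hp hq hpq (hdet i) U⁻¹ ?_
      change A₀.1 = _ * A.1
      rw [hU, ← Matrix.mul_assoc, ← Units.val_mul, inv_mul_cancel, Units.val_one, Matrix.one_mul]
    constructor
    · intro heq
      obtain ⟨rfl, heq⟩ := Sigma.mk.inj_iff.1 heq
      obtain ⟨V, -, hV⟩ := leftClass_eq_iff.1 (eq_of_heq heq)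
      exact hAM'.mul_left V hV
    · intro hM
      obtain ⟨V, hV, hn⟩ := hAM'.exists_unit hp hq hpq (hdet i) hM M₀.2 M.2
      -- Equivalent members of a complete system coincide, so the index `j` is determined as well.
      obtain rfl := hns.eq_of_apply_mulVec V hn
      rw [leftClass_eq_iff.2 ⟨V, hn, hV⟩]
  refine ⟨Υ, hiff, ?_, fun i A j M hM => ((hiff i A j M).1 hM).dividesPsi hp hq hpq (hdet i)⟩
  rintro ⟨i, c⟩ ⟨i', c'⟩ heq
  obtain ⟨A, rfl⟩ := Quotient.exists_rep c
  obtain ⟨A', rfl⟩ := Quotient.exists_rep c'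
  obtain ⟨j, M, hM⟩ := hex i A
  have h1 := (hiff i A j M).2 hM
  have h2 := (hiff i' A' j M).1 (heq.symm.trans h1)
  obtain ⟨V, hV, hn⟩ := hM.exists_unit_automorph hp hq hpq (hdet i) (hdet i') (hprim i A)
    (hprim i' A') h2
  obtain rfl := hqs.eq_of_apply_mulVec V hn
  exact congrArg (Sigma.mk i) (leftClass_eq_iff (A := A) (D := A') |>.2 ⟨V, hn, hV⟩)
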